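/- Let $m,n$ be positive integers. Write $R^{(k,l)}$ for the $k\times l$ matrices over $R$, $\sigma$ for the trace, and $\mathbb H=\{\tau=u+iv: v>0\}$. Let $\mathcal M$ be a positive definite symmetric real $m\times m$ matrix, and put $(x,y)_{\mathcal M}=\sigma({}^tx\mathcal M y)$, $\|x\|_{\mathcal M}^2=(x,x)_{\mathcal M}$ for $x,y\in\mathbb R^{(m,n)}$. **Setting.** Let $H$ be the Heisenberg group of triples $(\lambda,\mu;\kappa)$ with $\lambda,\mu\in\mathbb R^{(m,n)}$, $\kappa\in\mathbb R^{(m,m)}$ and $\kappa+\mu\,{}^t\lambda$ symmetric, with the law $(\lambda_0,\mu_0;\kappa_0)\circ(\lambda,\mu;\kappa)=(\lambda_0+\lambda,\mu_0+\mu;\kappa_0+\kappa+\lambda_0{}^t\mu-\mu_0{}^t\lambda)$. It acts on functions on $\mathbb R^{(m,n)}$ by $$[\mathscr W_{\mathcal M}(\lambda,\mu;\kappa)f](x)=e^{\pi i\,\sigma(\mathcal M(\kappa+\mu{}^t\lambda+2x{}^t\mu))}f(x+\lambda).$$ For $g=\begin{pmatrix}a&b\\c&d\end{pmatrix}\in SL(2,\mathbb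 R)$ and a Schwartz function $f$ on $\mathbb R^{(m,n)}$ let $$[R_{\mathcal M}(g)f](x)=\begin{cases}|a|^{mn/2}e^{\pi i ab\|x\|_{\mathcal M}^2}f(ax)&(c=0),\\ (\det\mathcal M)^{n/2}|c|^{-mn/2}\displaystyle\int_{\mathbb R^{(m,n)}}e^{\frac{\pi i}{c}(a\|x\|_{\mathcal M}^2+d\|y\|_{\mathcal M}^2-2(x,y)_{\mathcal M})}f(y)\,dy&(c\ne0).\end{cases}$$ For $\tau=u+iv\in\mathbb H$ and $\phi\in\mathbb R$ let $(\tau,\phi)$ denote the element $$\begin{pmatrix}1&u\\0&1\end{pmatrix}\begin{pmatrix}v^{1/2}&0\\0&v^{-1/2}\end{pmatrix}\begin{pmatrix}\cos\phi&-\sin\phi\\\sin\phi&\cos\phi\end{pmatrix}$$ of $SL(2,\mathbb R)$; it depends on $\phi$ only modulo $2\pi$. For a Schwartz function $f$ the theta sum is $$\Theta_f^{[\mathcal M]}(\tau,\phi;\lambda,\mu,\kappa)=\sum_{\omega\in\mathbb Z^{(m,n)}}\big[\mathscr W_{\mathcal M}(\lambda,\mu;\kappa)R_{\mathcal M}(\tau,\phi)f\big](\omega),$$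 and we also put $$\Theta_f^{[\mathcal M]}(\tau,\phi;\lambda,\mu)=v^{mn/4}\sum_{\omega\in\mathbb Z^{(m,n)}}e^{\pi i\{u\|\omega+\lambda\|_{\mathcal M}^2+2(\omega,\mu)_{\mathcal M}\}}[R_{\mathcal M}(i,\phi)f](v^{1/2}(\omega+\lambda)).$$ For $g_1,g_2\in SL(2,\mathbb R)$ let $c_{\mathcal M}(g_1,g_2)=e^{-\pi i\,mn\,\mathrm{sign}(c_1c_2c_3)/4}$, where $c_1,c_2,c_3$ are the lower left entries of $g_1,g_2,g_1g_2$ and $\mathrm{sign}(0)=0$. Let $S=\begin{pmatrix}0&-1\\1&0\end{pmatrix}$, and let $\arg$ be the principal argument, so $\arg\tau\in(0,\pi)$ for $\tau\in\mathbb H$. Let $G^{(m,n)}=SL(2,\mathbb R)\ltimes(\mathbb R^{(m,n)}\times\mathbb R^{(m,n)})$ with the law $(g_1,v_1)(g_2,v_2)=(g_1g_2,v_1g_2+v_2)$, where $(\lambda,\mu)\begin{pmatrix}a&b\\c&d\end{pmatrix}=(a\lambda+c\mu,b\lambda+d\mu)$. The element of $G^{(m,n)}$ with coordinates $(\tau,\phi;\lambda,\mu)$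 is the product $(I_2,(\lambda,\mu))\cdot((\tau,\phi),(0,0))$. Let $\Gamma^{(m,n)}_{[2]}$ be the subgroup of $G^{(m,n)}$ generated by $(S,(0,0))$, $\left(\begin{pmatrix}1&2\\0&1\end{pmatrix},(0,s)\right)$ and $(I_2,(\lambda_0,\mu_0))$ with $s,\lambda_0,\mu_0\in\mathbb Z^{(m,n)}$. **Theorem.** Let $\mathcal M$ be a positive definite symmetric integral $m\times m$ matrix, and let $f,g$ be Schwartz functions on $\mathbb R^{(m,n)}$. The series $\Theta_f^{[\mathcal M]}(\tau,\phi;\lambda,\mu,\kappa)$ converges absolutely, and for all $\tau\in\mathbb H$, $\phi\in\mathbb R$ and $(\lambda,\mu;\kappa)\in H$ the following hold. 1. (Jacobi 1) If $\mathcal M\,\mathbb Z^{(m,n)}=\mathbb Z^{(m,n)}$, then $$\Theta_f^{[\mathcal M]}\Big(-\frac1\tau,\phi+\arg\tau;-\mu,\lambda,\kappa\Big)=(\det\mathcal M)^{-n/2}\,c_{\mathcal M}(S,(\tau,\phi))\,\Theta_f^{[\mathcal M]}(\tau,\phi;\lambda,\mu,\kappa),$$ where $c_{\mathcal M}(S,(\tau,\phi))=e^{-\pi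 i\,mn\,\mathrm{sign}(\sin\phi\,\sin(\phi+\arg\tau))/4}$. 2. (Jacobi 2) For every $s\in\mathbb Z^{(m,n)}$, $$\Theta_f^{[\mathcal M]}(\tau+2,\phi;\lambda,s-2\lambda+\mu,\kappa-s\,{}^t\lambda)=\Theta_f^{[\mathcal M]}(\tau,\phi;\lambda,\mu,\kappa).$$ 3. (Jacobi 3) For every $(\lambda_0,\mu_0;\kappa_0)\in H$ with integral entries, $$\Theta_f^{[\mathcal M]}(\tau,\phi;\lambda+\lambda_0,\mu+\mu_0,\kappa+\kappa_0+\lambda_0{}^t\mu-\mu_0{}^t\lambda)=e^{\pi i\,\sigma(\mathcal M(\kappa_0+\mu_0{}^t\lambda_0))}\,\Theta_f^{[\mathcal M]}(\tau,\phi;\lambda,\mu,\kappa).$$ 4. If $\mathcal M\,\mathbb Z^{(m,n)}=\mathbb Z^{(m,n)}$ (so that $\mathcal M$ is unimodular), then the function $\Theta_f^{[\mathcal M]}(\tau,\phi;\lambda,\mu)\,\overline{\Theta_g^{[\mathcal M]}(\tau,\phi;\lambda,\mu)}$ on $G^{(m,n)}$ is invariant under left multiplication by $\Gamma^{(m,n)}_{[2]}$.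 -/

import Mathlib

open scoped Matrix SchwartzMap UpperHalfPlane

noncomputable section

namespace JacobiTheta

/-- Real `m × n` matrices. -/
abbrev RMat (m n : ℕ) := Matrix (Fin m) (Fin n) ℝ

/-- Integral `m × n` matrices. -/
abbrev ZMat (m n : ℕ) := Matrix (Fin m) (Fin n) ℤ

/-- An integral matrix regarded as a real matrix. -/
def toReal {m n : ℕ} (A : ZMat m n) : RMat m n := A.map (fun k : ℤ => (k : ℝ))

/-! ### The Heisenberg group -/

/-- The Heisenberg group: triples `(lam, mu; kap)` with `kap + mu * lamᵀ` symmetric. -/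
@[ext] structure Heis (m n : ℕ) where
  lam : RMat m n
  mu : RMat m n
  kap : RMat m m
  isSymm : (kap + mu * lamᵀ).IsSymm

variable {m n : ℕ}

theorem Heis.isSymm_mul (h k : Heis m n) :
    (h.kap + k.kap + h.lam * k.muᵀ - h.mu * k.lamᵀ +
      (h.mu + k.mu) * (h.lam + k.lam)ᵀ).IsSymm := by
  have h1 := h.isSymm
  have h2 := k.isSymm
  unfold Matrix.IsSymm at *
  simp only [Matrix.transpose_add, Matrix.transpose_sub, Matrix.transpose_mul,
    Matrix.transpose_transpose, Matrix.add_mul, Matrix.mul_add] at *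
  have e : h.kapᵀ = h.kap + h.mu * h.lamᵀ - h.lam * h.muᵀ := by rw [← h1]; abel
  have e' : k.kapᵀ = k.kap + k.mu * k.lamᵀ - k.lam * k.muᵀ := by rw [← h2]; abel
  rw [e, e']
  abel

/-- The multiplication law of the Heisenberg group. -/
instance : Mul (Heis m n) where
  mul h k := ⟨h.lam + k.lam, h.mu + k.mu,
    h.kap + k.kap + h.lam * k.muᵀ - h.mu * k.lamᵀ, h.isSymm_mul k⟩

/-- Elements all of whose entries are integers. -/
def Heis.IsIntegral (h : Heis m n) : Prop :=
  ∃ (l u : ZMat m n) (k : ZMat m m), h.lam = toReal l ∧ h.mu = toReal u ∧ h.kap = toReal k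

theorem Heis.isSymm_inversion (h : Heis m n) : (h.kap + h.lam * (-h.mu)ᵀ).IsSymm := by
  have h1 := h.isSymm
  unfold Matrix.IsSymm at *
  simp only [Matrix.transpose_add, Matrix.transpose_mul, Matrix.transpose_neg,
    Matrix.transpose_transpose, Matrix.mul_neg] at *
  have e : h.kapᵀ = h.kap + h.mu * h.lamᵀ - h.lam * h.muᵀ := by rw [← h1]; abel
  rw [e]
  abel

theorem Heis.isSymm_shift (h : Heis m n) (s : RMat m n) :
    (h.kap - s * h.lamᵀ + (s - (2 : ℝ) • h.lam + h.mu) * h.lamᵀ).IsSymm := by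
  have e : h.kap - s * h.lamᵀ + (s - (2 : ℝ) • h.lam + h.mu) * h.lamᵀ
      = (h.kap + h.mu * h.lamᵀ) - (2 : ℝ) • (h.lam * h.lamᵀ) := by
    simp only [Matrix.add_mul, Matrix.sub_mul, Matrix.smul_mul]
    abel
  rw [e]
  exact h.isSymm.sub (by
    unfold Matrix.IsSymm
    rw [Matrix.transpose_smul, Matrix.transpose_mul, Matrix.transpose_transpose])

/-! ### `SL(2, ℝ)` and its Iwasawa coordinates -/

/-- `SL(2, ℝ)`. -/
abbrev SL2R := Matrix.SpecialLinearGroup (Fin 2) ℝ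

/-- The matrix `(1 u; 0 1)`. -/
def unip (u : ℝ) : SL2R := ⟨!![1, u; 0, 1], by simp [Matrix.det_fin_two_of]⟩

/-- The matrix `(v^{1/2} 0; 0 v^{-1/2})`. -/
def diagEl (v : ℝ) (hv : 0 < v) : SL2R :=
  ⟨!![Real.sqrt v, 0; 0, (Real.sqrt v)⁻¹], by
    have : Real.sqrt v ≠ 0 := (Real.sqrt_pos.mpr hv).ne'
    simp [Matrix.det_fin_two_of, this]⟩

/-- The rotation `(cos φ, -sin φ; sin φ, cos φ)`. -/
def rot (φ : ℝ) : SL2R :=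
  ⟨!![Real.cos φ, -Real.sin φ; Real.sin φ, Real.cos φ], by
    rw [Matrix.det_fin_two_of]; nlinarith [Real.sin_sq_add_cos_sq φ]⟩

/-- The element `(τ, φ)` of `SL(2, ℝ)` with `τ = u + i v`. -/
def iwasawa (τ : ℍ) (φ : ℝ) : SL2R := unip τ.re * diagEl τ.im τ.im_pos * rot φ

/-- The matrix `S = (0 -1; 1 0)`. -/
def matS : SL2R := ⟨!![0, -1; 1, 0], by simp [Matrix.det_fin_two_of]⟩

theorem im_neg_one_div_pos (τ : ℍ) : 0 < (-1 / (τ : ℂ)).im := by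
  have h := τ.im_inv_neg_coe_pos
  rwa [show (-1 / (τ : ℂ)) = (-(τ : ℂ))⁻¹ by rw [inv_neg, neg_div, one_div]]

/-- The point `-1/τ` of the upper half plane. -/
def negInv (τ : ℍ) : ℍ := ⟨-1 / (τ : ℂ), im_neg_one_div_pos τ⟩

/-! ### The Schrödinger representation, the Weil representation and theta sums -/

/-- `(x, y)_M = tr(ᵗx M y)`. -/
def bil (M : RMat m m) (x y : RMat m n) : ℝ := (xᵀ * M * y).trace

/-- The Schrödinger representation of the Heisenberg group:
`[W(h₀) F](x) = exp(π i tr(M(κ₀ + μ₀ ᵗλ₀ + 2 x ᵗμ₀))) F(x + λ₀)`. -/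
def schrodinger (M : RMat m m) (h : Heis m n) (F : RMat m n → ℂ) (x : RMat m n) : ℂ :=
  Complex.exp (Real.pi * Complex.I *
    ((M * (h.kap + h.mu * h.lamᵀ + (2 : ℝ) • (x * h.muᵀ))).trace : ℝ)) * F (x + h.lam)

/-- The (projective) Weil representation of the matrix `(a b; c d)` of `SL(2, ℝ)`, embedded in
`Sp(n, ℝ)` as `(a I, b I; c I, d I)`, on functions on real `m × n` matrices. It is meant to be
applied to Schwartz functions, where the integral converges absolutely. -/
def weil (M : RMat m m) (g : SL2R) (F : RMat m n → ℂ) (x : RMat m n) : ℂ :=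
  let a := g.1 0 0
  let b := g.1 0 1
  let c := g.1 1 0
  let d := g.1 1 1
  if c = 0 then
    ((|a| ^ ((m * n : ℝ) / 2) : ℝ) : ℂ) *
      Complex.exp (Real.pi * Complex.I * (a * b * bil M x x : ℝ)) * F (a • x)
  else
    ((M.det ^ ((n : ℝ) / 2) * |c| ^ (-(m * n : ℝ) / 2) : ℝ) : ℂ) *
      ∫ y : Fin m → Fin n → ℝ,
        Complex.exp (Real.pi * Complex.I *
          ((a * bil M x x + d * bil M (Matrix.of y) (Matrix.of y)
            - 2 * bil M x (Matrix.of y)) / c : ℝ)) * F (Matrix.of y)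

/-- The projective representation `π(h g) = W(h) R(g)` of the Jacobi group. -/
def jacobiRep (M : RMat m m) (h : Heis m n) (g : SL2R) (F : RMat m n → ℂ) : RMat m n → ℂ :=
  schrodinger M h (weil M g F)

/-- A Schwartz function, regarded as a function of a matrix. -/
def onMat (f : 𝓢(Fin m → Fin n → ℝ, ℂ)) : RMat m n → ℂ := fun x => f (Matrix.of.symm x)

/-- The term of the theta sum indexed by the integral matrix `ω`. -/
def thetaTerm (M : RMat m m) (f : 𝓢(Fin m → Fin n → ℝ, ℂ)) (τ : ℍ) (φ : ℝ) (h : Heis m n)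
    (ω : ZMat m n) : ℂ :=
  jacobiRep M h (iwasawa τ φ) (onMat f) (toReal ω)

/-- The theta sum `Θ_f(τ, φ; λ, μ, κ)`, summed over all integral matrices. -/
def theta (M : RMat m m) (f : 𝓢(Fin m → Fin n → ℝ, ℂ)) (τ : ℍ) (φ : ℝ) (h : Heis m n) : ℂ :=
  ∑' ω : ZMat m n, thetaTerm M f τ φ h ω

/-- The cocycle `c(M₁, M₂) = exp(-π i m n sign(c₁ c₂ c₃) / 4)`, where `c₁, c₂, c₃` are the
lower left entries of `M₁`, `M₂` and `M₁ M₂`. -/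
def cocycle (m n : ℕ) (g₁ g₂ : SL2R) : ℂ :=
  Complex.exp (-(Complex.I * Real.pi * (m * n : ℝ) *
    (Real.sign (g₁.1 1 0 * g₂.1 1 0 * (g₁ * g₂).1 1 0) : ℝ) / 4))

/-- The theta sum `Θ_f(τ, φ; λ, μ)` without the central variable. -/
def thetaV (M : RMat m m) (f : 𝓢(Fin m → Fin n → ℝ, ℂ)) (τ : ℍ) (φ : ℝ)
    (lam mu : RMat m n) : ℂ :=
  ((τ.im ^ ((m * n : ℝ) / 4) : ℝ) : ℂ) *
    ∑' ω : ZMat m n,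
      Complex.exp (Real.pi * Complex.I *
        (τ.re * bil M (toReal ω + lam) (toReal ω + lam) + 2 * bil M (toReal ω) mu : ℝ)) *
      weil M (iwasawa UpperHalfPlane.I φ) (onMat f) (Real.sqrt τ.im • (toReal ω + lam))

/-! ### The group `SL(2, ℝ) ⋉ V(m, n)` -/

/-- `V(m, n)`, pairs of real `m × n` matrices. -/
abbrev VPair (m n : ℕ) := RMat m n × RMat m n

/-- The right action `(λ, μ) g = (a λ + c μ, b λ + d μ)` for `g = (a b; c d)`. -/
def rAct (p : VPair m n) (g : SL2R) : VPair m n :=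
  (g.1 0 0 • p.1 + g.1 1 0 • p.2, g.1 0 1 • p.1 + g.1 1 1 • p.2)

theorem rAct_one (p : VPair m n) : rAct p 1 = p := by
  simp [rAct]

theorem rAct_zero (g : SL2R) : rAct (0 : VPair m n) g = 0 := by
  simp [rAct]

theorem rAct_mul (p : VPair m n) (g k : SL2R) : rAct p (g * k) = rAct (rAct p g) k := by
  ext i j <;>
  · simp [rAct, Matrix.mul_apply, Fin.sum_univ_two]
    ring

theorem rAct_add (p q : VPair m n) (g : SL2R) : rAct (p + q) g = rAct p g + rAct q g := by
  ext i j <;>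
  · simp [rAct]
    ring

theorem rAct_neg (p : VPair m n) (g : SL2R) : rAct (-p) g = -rAct p g := by
  ext i j <;>
  · simp [rAct]
    ring

/-- The set underlying `SL(2, ℝ) ⋉ V(m, n)`. -/
@[ext] structure GV (m n : ℕ) where
  sl : SL2R
  vec : VPair m n

/-- The group law `(g₁, v₁)(g₂, v₂) = (g₁ g₂, v₁ g₂ + v₂)`. -/
instance : Mul (GV m n) where
  mul x y := ⟨x.sl * y.sl, rAct x.vec y.sl + y.vec⟩

instance : One (GV m n) where
  one := ⟨1, 0⟩

instance : Inv (GV m n) where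
  inv x := ⟨x.sl⁻¹, -rAct x.vec x.sl⁻¹⟩

theorem GV.mul_def (x y : GV m n) : x * y = ⟨x.sl * y.sl, rAct x.vec y.sl + y.vec⟩ := rfl

theorem GV.one_def : (1 : GV m n) = ⟨1, 0⟩ := rfl

theorem GV.inv_def (x : GV m n) : x⁻¹ = ⟨x.sl⁻¹, -rAct x.vec x.sl⁻¹⟩ := rfl

instance : Group (GV m n) :=
  Group.ofLeftAxioms
    (fun x y z => by
      simp only [GV.mul_def, mul_assoc, rAct_mul, rAct_add, add_assoc])
    (fun x => by simp [GV.mul_def, GV.one_def, rAct_zero])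
    (fun x => by
      simp [GV.mul_def, GV.one_def, GV.inv_def, rAct_neg, ← rAct_mul, rAct_one])

/-- The element of `SL(2, ℝ) ⋉ V(m, n)` with coordinates `(τ, φ; λ, μ)`: as in the
decomposition `h g` of the elements of the Jacobi group, it is the product
`(1, (λ, μ)) ((τ, φ), 0) = ((τ, φ), (λ, μ) (τ, φ))`. -/
def ofCoord (τ : ℍ) (φ : ℝ) (lam mu : RMat m n) : GV m n :=
  (⟨1, (lam, mu)⟩ : GV m n) * ⟨iwasawa τ φ, 0⟩

/-- The subgroup generated by `(S, (0, 0))`, `((1 2; 0 1), (0, s))` and `(1, (λ₀, μ₀))` with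
`s, λ₀, μ₀` integral. -/
def Gamma2 (m n : ℕ) : Subgroup (GV m n) :=
  Subgroup.closure
    ({⟨matS, 0⟩} ∪ {x | ∃ s : ZMat m n, x = ⟨unip 2, (0, toReal s)⟩} ∪
      {x | ∃ l u : ZMat m n, x = ⟨1, (toReal l, toReal u)⟩})

end JacobiTheta

end

open JacobiTheta

namespace JacobiTheta

open MeasureTheory Set Filter
open scoped Real Topology

/-! ### Poisson summation on `ℝ^ι` -/

section Poisson

variable {ι : Type*}

/-! The theta sum applies "sum over the integral matrices" to $\mathscr W(h)R(g)f$, and each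
transformation law says that this functional is preserved, up to a phase, by an element of the
Jacobi group. For integral Heisenberg elements and for $\begin{pmatrix}1&2\\0&1\end{pmatrix}$ the
sums agree term by term after at most a shift of $\omega$, because integrality of $\mathcal M$ makes
the exponents differ by $\pi i$ times an even integer (`theta_mul`, `theta_translation`).

For $S$ the operator is the Fourier transform attached to $\mathcal M$, so the law is Poisson
summation (`tsum_toReal_eq_tsum_integral`). The dual frequencies are $\mathcal M\omega$, and
$\omega\mapsto\mathcal M\omega$ permutes the lattice when $\mathcal M$ is unimodular
(`theta_inversion`).

The analytic core is the composition rule $R(Sg)=c(S,g)R(S)R(g)$. Writing $\mathcal M={}^tAA$ and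
substituting $x\mapsto Ax$ reduces it to a Euclidean space (`integral_exp_mul_weilV`). There it
becomes the Fourier transform of a chirp times a Fourier transform, found by Gaussian regularisation
(`fourier_chirp_mul_fourier`). The cocycle is the phase of the principal branch of $(i/t)^{N/2}$.

All multipliers have modulus one and do not depend on $f$, so they cancel in
$\Theta_f\overline{\Theta_g}$. The generators of the group move the coordinates
$(\tau,\phi;\lambda,\mu)$ exactly as in these laws, and induction over the generated subgroup
finishes. -/

/-- The half-open unit cube with lower corner `k`. -/
def unitCube (k : ι → ℤ) : Set (ι → ℝ) := {x | ∀ i, x i ∈ Ioc (k i : ℝ) (k i + 1)}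

/-- An integral vector regarded as a real vector. -/
def castVec (k : ι → ℤ) : ι → ℝ := fun i => (k i : ℝ)

theorem unitCube_eq_pi (k : ι → ℤ) :
    unitCube k = Set.pi univ fun i => Ioc (k i : ℝ) (k i + 1) := by
  ext x; simp [unitCube]

/-- The cubes are open on the left, so the corner is the ceiling minus one. This formula gives
disjointness and covering at once. -/
theorem mem_unitCube_iff {k : ι → ℤ} {x : ι → ℝ} :
    x ∈ unitCube k ↔ k = fun i => ⌈x i⌉ - 1 := by
  have : ∀ i, x i ∈ Ioc (k i : ℝ) (k i + 1) ↔ k i = ⌈x i⌉ - 1 := fun i => by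
    rw [eq_sub_iff_add_eq, eq_comm, Int.ceil_eq_iff]
    simp [mem_Ioc]
  simp only [unitCube, mem_ofPred_eq, this, funext_iff]

theorem pairwise_disjoint_unitCube :
    Pairwise (Function.onFun Disjoint (unitCube : (ι → ℤ) → Set (ι → ℝ))) := by
  intro k l hkl
  refine Set.disjoint_left.mpr fun x hk hl => hkl ?_
  rw [mem_unitCube_iff] at hk hl
  rw [hk, hl]

theorem iUnion_unitCube : ⋃ k, (unitCube k : Set (ι → ℝ)) = univ :=
  eq_univ_of_forall fun _ => mem_iUnion.mpr ⟨_, mem_unitCube_iff.mpr rfl⟩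

/-- The projection of `ℝ^ι` onto the torus. -/
def torusMk (x : ι → ℝ) : UnitAddTorus ι := fun i => (x i : UnitAddCircle)

/-- Openness matters because products of open quotient maps are again quotient maps; a function on
the torus is then continuous as soon as its pullback is. -/
theorem isOpenQuotientMap_torusMk :
    IsOpenQuotientMap (torusMk : (ι → ℝ) → UnitAddTorus ι) :=
  IsOpenQuotientMap.piMap fun _ => QuotientAddGroup.isOpenQuotientMap_mk

theorem eq_add_castVec_of_torusMk_eq {x y : ι → ℝ} (h : torusMk x = torusMk y) :
    ∃ l : ι → ℤ, y = x + castVec l := by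
  have h1 : ∀ i, ∃ l : ℤ, y i = x i + l := fun i => by
    have := congrFun h i
    have h0 : ((y i - x i : ℝ) : UnitAddCircle) = 0 := by
      rw [AddCircle.coe_sub, sub_eq_zero]
      exact this.symm
    obtain ⟨l, hl⟩ := AddCircle.coe_eq_zero_iff (1 : ℝ) |>.mp h0
    exact ⟨l, by rw [zsmul_one] at hl; linarith⟩
  choose l hl using h1
  exact ⟨l, funext hl⟩

/-- The periodization of a function. -/
noncomputable def periodize (f : (ι → ℝ) → ℂ) (x : ι → ℝ) : ℂ := ∑' k : ι → ℤ, f (x + castVec k)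

theorem periodize_add_castVec (f : (ι → ℝ) → ℂ) (x : ι → ℝ) (l : ι → ℤ) :
    periodize f (x + castVec l) = periodize f x := by
  unfold periodize
  rw [← (Equiv.addLeft l).tsum_eq fun k : ι → ℤ => f (x + castVec k)]
  refine tsum_congr fun k => ?_
  congr 1
  ext i
  simp [castVec]
  ring

variable [Fintype ι]

theorem measurableSet_unitCube (k : ι → ℤ) : MeasurableSet (unitCube k) := by
  rw [unitCube_eq_pi]
  exact MeasurableSet.univ_pi fun i => measurableSet_Ioc

theorem volume_unitCube (k : ι → ℤ) : volume (unitCube k) = 1 := by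
  rw [unitCube_eq_pi, Real.volume_pi_Ioc]
  simp

theorem hasSum_integral_unitCube {F : Type*} [NormedAddCommGroup F] [NormedSpace ℝ F]
    {f : (ι → ℝ) → F} (hf : Integrable f) :
    HasSum (fun k => ∫ x in unitCube k, f x) (∫ x, f x) := by
  have := hasSum_integral_iUnion (μ := volume) (f := f) measurableSet_unitCube
    (pairwise_disjoint_unitCube (ι := ι)) hf.integrableOn
  rwa [iUnion_unitCube, Measure.restrict_univ] at this

theorem integral_unitCube_eq {F : Type*} [NormedAddCommGroup F] [NormedSpace ℝ F]
    (f : (ι → ℝ) → F) (k : ι → ℤ) :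
    ∫ x in unitCube k, f x = ∫ x in unitCube (0 : ι → ℤ), f (x + castVec k) := by
  have h := (measurePreserving_add_right (volume : Measure (ι → ℝ)) (castVec k))
  have := h.setIntegral_preimage_emb (measurableEmbedding_addRight (castVec k)) f (unitCube k)
  rw [← this]
  congr 2
  ext x
  simp [unitCube, castVec, add_comm (x _) (k _ : ℝ)]

theorem norm_le_of_mem_unitCube {k : ι → ℤ} {x : ι → ℝ} (hx : x ∈ unitCube k) :
    ‖x‖ ≤ ‖castVec k‖ + 1 := by
  refine (pi_norm_le_iff_of_nonneg (by positivity)).mpr fun i => ?_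
  have h1 := norm_le_pi_norm (castVec k) i
  have h2 := hx i
  rw [Real.norm_eq_abs] at h1 ⊢
  have h3 : |x i - castVec k i| ≤ 1 := by
    rw [abs_le]; simp only [castVec]; constructor <;> linarith [h2.1, h2.2]
  have := abs_add_le (x i - castVec k i) (castVec k i)
  rw [sub_add_cancel] at this
  linarith

/-- Comparison with the convergent integral of $(1+\|x\|)^{-r}$: on the cube at $k$ one has
$1+\|x\|\le 2(1+\|k\|)$, which costs the factor $2^r$. -/
theorem summable_one_add_norm_castVec {r : ℝ} (hr : (Fintype.card ι : ℝ) < r) :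
    Summable fun k : ι → ℤ => (1 + ‖castVec k‖) ^ (-r) := by
  have hr0 : 0 < r := lt_of_le_of_lt (Nat.cast_nonneg _) hr
  have hi : Integrable fun x : ι → ℝ => (1 + ‖x‖) ^ (-r) :=
    integrable_one_add_norm (by simpa using hr)
  have hs := (hasSum_integral_unitCube hi).summable.mul_left (2 ^ r)
  refine Summable.of_nonneg_of_le (fun k => by positivity) (fun k => ?_) hs
  have hv : (volume : Measure (ι → ℝ)).real (unitCube k) = 1 := by
    simp [Measure.real, volume_unitCube]
  have h1 : ∫ _ in unitCube k, 2 ^ (-r) * (1 + ‖castVec k‖) ^ (-r) ≤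
      ∫ x in unitCube k, (1 + ‖x‖) ^ (-r) := by
    refine setIntegral_mono_on (integrableOn_const (by simp [volume_unitCube])) hi.integrableOn
      (measurableSet_unitCube k) fun x hx => ?_
    rw [← Real.mul_rpow (by norm_num) (by positivity)]
    refine Real.rpow_le_rpow_of_nonpos (by positivity) ?_ (by linarith)
    have := norm_le_of_mem_unitCube hx
    linarith [norm_nonneg (castVec k)]
  rw [setIntegral_const, hv, one_smul] at h1
  calc (1 + ‖castVec k‖) ^ (-r) = 2 ^ r * (2 ^ (-r) * (1 + ‖castVec k‖) ^ (-r)) := by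
        rw [← mul_assoc, ← Real.rpow_add (by norm_num)]; simp
    _ ≤ _ := by gcongr

/-- A uniform bound for the translates of a function with polynomial decay. -/
theorem norm_comp_add_le_of_decay {f : (ι → ℝ) → ℂ} {C r : ℝ} (hr : 0 ≤ r)
    (hf : ∀ x, ‖f x‖ ≤ C * (1 + ‖x‖) ^ (-r)) (x : ι → ℝ) (y : ι → ℝ) :
    ‖f (x + y)‖ ≤ C * (1 + ‖x‖) ^ r * (1 + ‖y‖) ^ (-r) := by
  have hC : 0 ≤ C := by simpa using (norm_nonneg _).trans (hf 0)
  refine (hf _).trans ?_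
  rw [mul_assoc]
  gcongr
  -- Peetre's inequality, which moves the decay from $x+y$ to $y$ at the price of a power of
  -- $1+\|x\|$.
  have h : (1 + ‖y‖) ≤ (1 + ‖x‖) * (1 + ‖x + y‖) := by
    have : ‖y‖ ≤ ‖x + y‖ + ‖x‖ := by
      simpa using norm_sub_le (x + y) x
    nlinarith [norm_nonneg x, norm_nonneg (x + y)]
  have h2 := Real.rpow_le_rpow (by positivity) h hr
  rw [Real.mul_rpow (by positivity) (by positivity)] at h2
  rw [Real.rpow_neg (by positivity), Real.rpow_neg (by positivity), ← div_eq_mul_inv,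
    inv_le_comm₀ (by positivity) (by positivity), inv_div, div_le_iff₀ (by positivity), mul_comm]
  exact h2

theorem summable_comp_castVec_of_decay {f : (ι → ℝ) → ℂ} {C r : ℝ}
    (hr : (Fintype.card ι : ℝ) < r) (hf : ∀ x, ‖f x‖ ≤ C * (1 + ‖x‖) ^ (-r)) (x : ι → ℝ) :
    Summable fun k : ι → ℤ => f (x + castVec k) :=
  Summable.of_norm_bounded ((summable_one_add_norm_castVec hr).mul_left _)
    fun k => norm_comp_add_le_of_decay ((Nat.cast_nonneg _).trans hr.le) hf x (castVec k)

theorem continuous_periodize {f : (ι → ℝ) → ℂ} (hc : Continuous f) {C r : ℝ}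
    (hr : (Fintype.card ι : ℝ) < r) (hf : ∀ x, ‖f x‖ ≤ C * (1 + ‖x‖) ^ (-r)) :
    Continuous (periodize f) := by
  have hr0 : 0 ≤ r := (Nat.cast_nonneg _).trans hr.le
  have hC : 0 ≤ C := by simpa using (norm_nonneg _).trans (hf 0)
  refine continuous_iff_continuousAt.mpr fun x₀ => ?_
  have : ContinuousOn (periodize f) (Metric.ball x₀ 1) := by
    refine continuousOn_tsum (u := fun k => C * (1 + (‖x₀‖ + 1)) ^ r * (1 + ‖castVec k‖) ^ (-r))
      (fun k => by fun_prop) ((summable_one_add_norm_castVec hr).mul_left _) fun k x hx => ?_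
    refine (norm_comp_add_le_of_decay hr0 hf x (castVec k)).trans ?_
    have : ‖x‖ ≤ ‖x₀‖ + 1 := by
      have h1 := mem_ball_iff_norm.mp hx
      have h2 := norm_add_le (x - x₀) x₀
      rw [sub_add_cancel] at h2
      linarith
    gcongr
  exact this.continuousAt (Metric.ball_mem_nhds x₀ one_pos)

/-- The character `x ↦ exp(-2πi k·x)`. -/
noncomputable def expChar (k : ι → ℤ) (x : ι → ℝ) : ℂ :=
  Complex.exp (-(2 * π * Complex.I * (∑ i, (k i : ℝ) * x i : ℝ)))

theorem continuous_expChar (k : ι → ℤ) : Continuous (expChar k) := by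
  unfold expChar
  fun_prop

theorem norm_expChar (k : ι → ℤ) (x : ι → ℝ) : ‖expChar k x‖ = 1 := by
  rw [expChar, Complex.norm_exp]
  simp

theorem expChar_add_castVec (k l : ι → ℤ) (x : ι → ℝ) :
    expChar k (x + castVec l) = expChar k x := by
  unfold expChar
  rw [Complex.exp_eq_exp_iff_exists_int]
  refine ⟨-∑ i, k i * l i, ?_⟩
  simp only [castVec, Pi.add_apply, mul_add, Finset.sum_add_distrib]
  push_cast
  ring

theorem mFourier_neg_torusMk (k : ι → ℤ) (x : ι → ℝ) :
    UnitAddTorus.mFourier (-k) (torusMk x) = expChar k x := by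
  simp only [UnitAddTorus.mFourier, ContinuousMap.coe_mk, torusMk, fourier_coe_apply, expChar,
    ← Complex.exp_sum]
  congr 1
  push_cast
  rw [Finset.mul_sum, ← Finset.sum_neg_distrib]
  refine Finset.sum_congr rfl fun i _ => ?_
  simp
  ring

theorem integrable_of_decay {f : (ι → ℝ) → ℂ} (hc : Continuous f) {C r : ℝ}
    (hr : (Fintype.card ι : ℝ) < r) (hf : ∀ x, ‖f x‖ ≤ C * (1 + ‖x‖) ^ (-r)) : Integrable f :=
  ((integrable_one_add_norm (by simpa using hr)).const_mul C).mono' hc.aestronglyMeasurable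
    (ae_of_all _ hf)

/-- **Poisson summation** for continuous functions with polynomial decay whose Fourier transform
is summable over the integral vectors. -/
theorem tsum_castVec_eq_tsum_fourier {f : (ι → ℝ) → ℂ} (hc : Continuous f) {C r : ℝ}
    (hr : (Fintype.card ι : ℝ) < r) (hf : ∀ x, ‖f x‖ ≤ C * (1 + ‖x‖) ^ (-r))
    (hs : Summable fun k : ι → ℤ => ∫ x, expChar k x * f x) :
    ∑' k : ι → ℤ, f (castVec k) = ∑' k : ι → ℤ, ∫ x, expChar k x * f x := by
  have hq := isOpenQuotientMap_torusMk (ι := ι)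
  have hF : ∀ x, periodize f (Function.surjInv hq.surjective (torusMk x)) = periodize f x := by
    intro x
    obtain ⟨l, hl⟩ := eq_add_castVec_of_torusMk_eq
      (Function.surjInv_eq hq.surjective (torusMk x)).symm
    rw [hl, periodize_add_castVec]
  -- The section `Function.surjInv` is not continuous; continuity holds because the pullback to
  -- $\mathbb R^\iota$ is the periodization, whatever representative is chosen.
  let F : C(UnitAddTorus ι, ℂ) := ⟨fun t => periodize f (Function.surjInv hq.surjective t), by
    rw [← hq.continuous_comp_iff]
    exact (continuous_periodize hc hr hf).congr fun x => (hF x).symm⟩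
  have hFx : ∀ x, F (torusMk x) = periodize f x := hF
  have hcoef : ∀ k, UnitAddTorus.mFourierCoeff F k = ∫ x, expChar k x * f x := by
    intro k
    have hi : Integrable fun x => expChar k x * f x :=
      (integrable_of_decay hc hr hf).mono
        ((continuous_expChar k).mul hc).aestronglyMeasurable
        (ae_of_all _ fun x => by rw [norm_mul, norm_expChar, one_mul])
    have hset : {x : ι → ℝ | ∀ i, x i ∈ Ioc ((0 : ι → ℝ) i) ((0 : ι → ℝ) i + 1)} =
        unitCube (0 : ι → ℤ) := by
      ext x; simp [unitCube]
    have h2 : ∀ l : ι → ℤ, ∫ x in unitCube l, expChar k x * f x =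
        ∫ x in unitCube (0 : ι → ℤ), expChar k x * f (x + castVec l) := by
      intro l
      rw [integral_unitCube_eq]
      simp only [expChar_add_castVec]
    have h3 : ∀ l : ι → ℤ, ∫ x in unitCube l, ‖expChar k x * f x‖ =
        ∫ x in unitCube (0 : ι → ℤ), ‖expChar k x * f (x + castVec l)‖ := by
      intro l
      rw [integral_unitCube_eq]
      simp only [expChar_add_castVec]
    have hint : ∀ l : ι → ℤ, Integrable (fun x => expChar k x * f (x + castVec l)) := by
      intro l
      have := hi.comp_add_right (castVec l)
      simpa only [expChar_add_castVec] using this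
    -- Unfolding: sum and integral over one cube may be exchanged, since the norms integrate over
    -- all translated cubes to the finite $L^1$ norm.
    have h4 := hasSum_integral_of_summable_integral_norm
      (μ := volume.restrict (unitCube (0 : ι → ℤ)))
      (F := fun l x => expChar k x * f (x + castVec l)) (fun l => (hint l).integrableOn)
      (by simpa only [h3] using (hasSum_integral_unitCube hi.norm).summable)
    rw [UnitAddTorus.mFourierCoeff_eq_integral _ _ 0, hset]
    have h5 : ∀ x : ι → ℝ, UnitAddTorus.mFourier (-k) (fun i => (x i : UnitAddCircle)) •
        F (fun i => (x i : UnitAddCircle)) = ∑' l : ι → ℤ, expChar k x * f (x + castVec l) := by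
      intro x
      have e1 := mFourier_neg_torusMk k x
      have e2 := hFx x
      unfold torusMk at e1 e2
      rw [e1, e2, periodize, smul_eq_mul, tsum_mul_left]
    simp only [h5]
    have h6 := hasSum_integral_unitCube hi
    simp only [h2] at h6
    exact h4.unique h6
  have hsum : Summable (UnitAddTorus.mFourierCoeff F) := by
    rw [show UnitAddTorus.mFourierCoeff F = fun k => ∫ x, expChar k x * f x from funext hcoef]
    exact hs
  -- At the origin of the torus every character is 1, so the Fourier series becomes the sum of its
  -- coefficients.
  have := (UnitAddTorus.hasSum_mFourier_series_apply_of_summable hsum (torusMk 0)).tsum_eq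
  rw [hFx, periodize] at this
  simp only [zero_add] at this
  rw [← this]
  refine tsum_congr fun k => ?_
  have h1 : UnitAddTorus.mFourier k (torusMk 0) = 1 := by
    simpa [expChar] using mFourier_neg_torusMk (-k) (0 : ι → ℝ)
  rw [h1, smul_eq_mul, mul_one, hcoef]

end Poisson
/-! ### The Weil representation of `SL(2, ℝ)` on a Euclidean space -/

section Weil

open scoped FourierTransform RealInnerProductSpace

theorem hasTemperateGrowth_cexp_mul_I (c : ℝ) :
    Function.HasTemperateGrowth fun t : ℝ => Complex.exp (Complex.I * (c * t : ℝ)) := by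
  have hd : ∀ n : ℕ, iteratedDeriv n (fun t : ℝ => Complex.exp (Complex.I * (c * t : ℝ))) =
      fun t => (Complex.I * c) ^ n * Complex.exp (Complex.I * (c * t : ℝ)) := by
    intro n
    induction n with
    | zero => simp
    | succ n ih =>
      rw [iteratedDeriv_succ, ih]
      ext t
      have h : HasDerivAt (fun t : ℝ => Complex.I * ((c * t : ℝ) : ℂ)) (Complex.I * c) t := by
        have h1 : HasDerivAt (fun t : ℝ => ((c * t : ℝ) : ℂ)) ((c * 1 : ℝ) : ℂ) t :=
          ((hasDerivAt_id t).const_mul c).ofReal_comp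
        simpa using h1.const_mul Complex.I
      rw [(h.cexp.const_mul ((Complex.I * c) ^ n)).deriv]
      ring
  refine ⟨?_, fun n => ⟨0, |c| ^ n, fun t => ?_⟩⟩
  · have h1 : ContDiff ℝ ⊤ fun t : ℝ => ((c * t : ℝ) : ℂ) :=
      Complex.ofRealCLM.contDiff.comp (contDiff_const.mul contDiff_id)
    exact ((contDiff_const.mul h1).cexp).of_le le_top
  · rw [norm_iteratedFDeriv_eq_norm_iteratedDeriv, hd, norm_mul, norm_pow, norm_mul,
      Complex.norm_exp]
    simp

variable {V : Type*} [NormedAddCommGroup V] [InnerProductSpace ℝ V]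

/-- The quadratic chirp `x ↦ exp(π i t ‖x‖²)`. -/
noncomputable def chirp (t : ℝ) (x : V) : ℂ := Complex.exp (π * Complex.I * (t * ‖x‖ ^ 2 : ℝ))

theorem hasTemperateGrowth_chirp (t : ℝ) : Function.HasTemperateGrowth (chirp t : V → ℂ) := by
  have := (hasTemperateGrowth_cexp_mul_I (π * t)).comp (Function.hasTemperateGrowth_norm_sq V)
  convert this using 1
  ext x
  simp only [chirp, Function.comp_apply]
  congr 1
  push_cast
  ring

/-- The product of a chirp and a Schwartz function. -/
noncomputable def chirpMul (t : ℝ) (f : 𝓢(V, ℂ)) : 𝓢(V, ℂ) := SchwartzMap.smulLeftCLM ℂ (chirp t) f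

theorem chirpMul_apply (t : ℝ) (f : 𝓢(V, ℂ)) (x : V) : chirpMul t f x = chirp t x * f x := by
  rw [chirpMul, SchwartzMap.smulLeftCLM_apply_apply (hasTemperateGrowth_chirp t), smul_eq_mul]

/-- The dilation of a Schwartz function. -/
noncomputable def dilate (a : ℝ) (ha : a ≠ 0) (f : 𝓢(V, ℂ)) : 𝓢(V, ℂ) :=
  SchwartzMap.compCLMOfContinuousLinearEquiv ℂ (ContinuousLinearEquiv.smulLeft (Units.mk0 a ha)) f

theorem dilate_apply (a : ℝ) (ha : a ≠ 0) (f : 𝓢(V, ℂ)) (x : V) : dilate a ha f x = f (a • x) := by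
  simp [dilate, Units.smul_def]

/-- The base equals $i/t$, whose principal argument is $\mathrm{sign}(t)\pi/2$. This is where the
sign in the cocycle originates. -/
theorem cpow_pi_div_neg_pi_mul_I {t : ℝ} (ht : t ≠ 0) (r : ℝ) :
    (π / (-(π * Complex.I * t)) : ℂ) ^ (r : ℂ) =
      Complex.exp (Complex.I * π * r * (Real.sign t : ℝ) / 2) * ((|t| ^ (-r) : ℝ) : ℂ) := by
  have h0 : (π / (-(π * Complex.I * t)) : ℂ) = Complex.I / t := by
    have h1 : (π : ℂ) ≠ 0 := by exact_mod_cast Real.pi_ne_zero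
    have h2 : (t : ℂ) ≠ 0 := by exact_mod_cast ht
    have h3 := Complex.I_ne_zero
    field_simp
    simp
  have hlog : Complex.log (Complex.I / t) =
      -(Real.log |t| : ℝ) + Complex.I * π * (Real.sign t : ℝ) / 2 := by
    rcases lt_or_gt_of_ne ht with hn | hp
    · have h1 : Complex.I / t = ((|t|⁻¹ : ℝ) : ℂ) * -Complex.I := by
        rw [abs_of_neg hn]; push_cast; rw [inv_neg]; ring
      rw [h1, Complex.log_ofReal_mul (by positivity) (neg_ne_zero.mpr Complex.I_ne_zero),
        Complex.log_neg_I, Real.log_inv, Real.sign_of_neg hn]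
      push_cast
      ring
    · have h1 : Complex.I / t = ((|t|⁻¹ : ℝ) : ℂ) * Complex.I := by
        rw [abs_of_pos hp]; push_cast; ring
      rw [h1, Complex.log_ofReal_mul (by positivity) Complex.I_ne_zero,
        Complex.log_I, Real.log_inv, Real.sign_of_pos hp]
      push_cast
      ring
  rw [h0, Complex.cpow_def_of_ne_zero (div_ne_zero Complex.I_ne_zero (by exact_mod_cast ht)), hlog,
    Real.rpow_def_of_pos (abs_pos.mpr ht), Complex.ofReal_exp, ← Complex.exp_add]
  congr 1
  push_cast
  ring

variable [FiniteDimensional ℝ V] [MeasurableSpace V] [BorelSpace V]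

open Module (finrank)

/-- The action of the matrix `(a b; c d)` of `SL(2, ℝ)` on functions on a Euclidean space. -/
noncomputable def weilV (a b c d : ℝ) (f : V → ℂ) (x : V) : ℂ :=
  if c = 0 then
    ((|a| ^ ((finrank ℝ V : ℝ) / 2) : ℝ) : ℂ) *
      Complex.exp (π * Complex.I * (a * b * ‖x‖ ^ 2 : ℝ)) * f (a • x)
  else
    ((|c| ^ (-(finrank ℝ V : ℝ) / 2) : ℝ) : ℂ) *
      ∫ y, Complex.exp (π * Complex.I *
        ((a * ‖x‖ ^ 2 + d * ‖y‖ ^ 2 - 2 * ⟪x, y⟫) / c : ℝ)) * f y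

/-- Factors the kernel operator as chirp, Fourier transform, dilation, chirp. Each factor preserves
Schwartz functions. -/
theorem weilV_of_ne_zero {a b c d : ℝ} (hc : c ≠ 0) (f : 𝓢(V, ℂ)) (x : V) :
    weilV a b c d f x = ((|c| ^ (-(finrank ℝ V : ℝ) / 2) : ℝ) : ℂ) *
      (chirp (a / c) x * 𝓕 (chirpMul (d / c) f) (c⁻¹ • x)) := by
  rw [weilV, if_neg hc, SchwartzMap.fourier_coe, Real.fourier_eq']
  congr 1
  rw [← integral_const_mul]
  refine integral_congr_ae (ae_of_all _ fun y => ?_)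
  simp only [chirpMul_apply, smul_eq_mul]
  unfold chirp
  rw [← mul_assoc (Complex.exp _) (Complex.exp _) (f y), ← Complex.exp_add, ← mul_assoc,
    ← Complex.exp_add]
  congr 2
  rw [inner_smul_right, real_inner_comm]
  push_cast
  field_simp
  ring

theorem exists_schwartz_eq_weilV {a b c d : ℝ} (h : a * d - b * c = 1) (f : 𝓢(V, ℂ)) :
    ∃ F : 𝓢(V, ℂ), ∀ x, weilV a b c d f x = F x := by
  by_cases hc : c = 0
  · have ha : a ≠ 0 := by rintro rfl; simp [hc] at h
    refine ⟨((|a| ^ ((finrank ℝ V : ℝ) / 2) : ℝ) : ℂ) • chirpMul (a * b) (dilate a ha f),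
      fun x => ?_⟩
    simp [weilV, hc, chirpMul_apply, dilate_apply, chirp, mul_assoc]
  · refine ⟨((|c| ^ (-(finrank ℝ V : ℝ) / 2) : ℝ) : ℂ) •
      chirpMul (a / c) (dilate c⁻¹ (inv_ne_zero hc) (𝓕 (chirpMul (d / c) f))), fun x => ?_⟩
    rw [weilV_of_ne_zero hc]
    simp [chirpMul_apply, dilate_apply]

/-- The multiplication formula moves the Fourier transform from $h$ onto the Gaussian, where it is
explicit because $\mathrm{Re}\,b>0$. -/
theorem integral_gaussian_mul_fourier {b : ℂ} (hb : 0 < b.re) (h : 𝓢(V, ℂ)) (ξ : V) :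
    ∫ z, Complex.exp (-b * ‖z‖ ^ 2 + 2 * π * Complex.I * ⟪-ξ, z⟫) * 𝓕 h z =
      ∫ y, (π / b) ^ (finrank ℝ V / 2 : ℂ) * Complex.exp (-π ^ 2 * ‖-ξ - y‖ ^ 2 / b) * h y := by
  have hi := GaussianFourier.integrable_cexp_neg_mul_sq_norm_add hb (2 * π * Complex.I) (-ξ)
  have := VectorFourier.integral_fourierIntegral_smul_eq_flip (L := innerₗ V) (μ := volume)
    (ν := volume) Real.continuous_fourierChar continuous_inner hi h.integrable
  have hflip : VectorFourier.fourierIntegral Real.fourierChar volume (innerₗ V).flip ⇑h = 𝓕 h := by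
    rw [flip_innerₗ]; rfl
  rw [hflip] at this
  simp only [smul_eq_mul] at this
  rw [← this]
  refine integral_congr_ae (ae_of_all _ fun y => ?_)
  simp only
  rw [← fourier_gaussian_innerProductSpace' hb (-ξ) y]
  rfl

/-- The chirp is the limit of the Gaussians with parameter $b=\varepsilon-\pi it$ as
$\varepsilon\to0^+$. Both sides of `integral_gaussian_mul_fourier` converge by dominated
convergence, with the Schwartz factor as dominating function. -/
theorem fourier_chirp_mul_fourier {t : ℝ} (ht : t ≠ 0) (h : 𝓢(V, ℂ)) (ξ : V) :
    𝓕 (chirpMul t (𝓕 h)) ξ =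
      Complex.exp (Complex.I * π * (finrank ℝ V : ℝ) * (Real.sign t : ℝ) / 4) *
        ((|t| ^ (-(finrank ℝ V : ℝ) / 2) : ℝ) : ℂ) *
        ∫ y, Complex.exp (π * Complex.I * (-(‖ξ + y‖ ^ 2) / t : ℝ)) * h y := by
  have hb0 : (-(π * Complex.I * t)) ≠ 0 := by
    simp [Real.pi_ne_zero, ht]
  let b : ℝ → ℂ := fun ε => ε + -(π * Complex.I * t)
  have hbre : ∀ ε, (b ε).re = ε := fun ε => by simp [b]
  have hbc : Continuous b := by fun_prop
  have hb : Tendsto b (𝓝[>] 0) (𝓝 (-(π * Complex.I * t))) := by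
    have := (hbc.tendsto 0).mono_left (nhdsWithin_le_nhds (s := Ioi 0))
    simpa [b] using this
  have hre : ∀ᶠ ε in 𝓝[>] (0 : ℝ), 0 < (b ε).re := by
    filter_upwards [self_mem_nhdsWithin] with ε hε
    rw [hbre]; exact hε
  have hL : Tendsto (fun ε => ∫ z, Complex.exp (-b ε * ‖z‖ ^ 2 + 2 * π * Complex.I * ⟪-ξ, z⟫) *
      𝓕 h z) (𝓝[>] 0) (𝓝 (∫ z, Complex.exp (-(-(π * Complex.I * t)) * ‖z‖ ^ 2 +
        2 * π * Complex.I * ⟪-ξ, z⟫) * 𝓕 h z)) := by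
    refine tendsto_integral_filter_of_dominated_convergence (fun z => ‖𝓕 h z‖) ?_ ?_
      (𝓕 h).integrable.norm ?_
    · refine Eventually.of_forall fun ε => Continuous.aestronglyMeasurable ?_
      exact Continuous.mul (by fun_prop) (𝓕 h).continuous
    · filter_upwards [hre] with ε hε
      refine ae_of_all _ fun z => ?_
      rw [norm_mul]
      refine mul_le_of_le_one_left (norm_nonneg _) ?_
      rw [Complex.norm_exp, Real.exp_le_one_iff]
      rw [hbre] at hε
      have : (-b ε * ‖z‖ ^ 2 + 2 * π * Complex.I * ⟪-ξ, z⟫).re = -(ε * ‖z‖ ^ 2) := by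
        simp [b, ← Complex.ofReal_pow]
      rw [this]
      have := mul_nonneg hε.le (sq_nonneg ‖z‖)
      linarith
    · refine ae_of_all _ fun z => ?_
      refine Tendsto.mul_const _ ?_
      refine (Complex.continuous_exp.tendsto _).comp ?_
      exact ((hb.neg.mul_const _).add_const _)
  have hR : Tendsto (fun ε => ∫ y, (π / b ε) ^ (finrank ℝ V / 2 : ℂ) *
      Complex.exp (-π ^ 2 * ‖-ξ - y‖ ^ 2 / b ε) * h y) (𝓝[>] 0)
      (𝓝 ((π / (-(π * Complex.I * t))) ^ (finrank ℝ V / 2 : ℂ) *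
        ∫ y, Complex.exp (-π ^ 2 * ‖-ξ - y‖ ^ 2 / (-(π * Complex.I * t))) * h y)) := by
    have e : ∀ ε, ∫ y, (π / b ε) ^ (finrank ℝ V / 2 : ℂ) *
        Complex.exp (-π ^ 2 * ‖-ξ - y‖ ^ 2 / b ε) * h y = (π / b ε) ^ (finrank ℝ V / 2 : ℂ) *
        ∫ y, Complex.exp (-π ^ 2 * ‖-ξ - y‖ ^ 2 / b ε) * h y := fun ε => by
      rw [← integral_const_mul]; simp only [mul_assoc]
    simp only [e]
    refine Tendsto.mul ?_ ?_
    · have hslit : (π / (-(π * Complex.I * t)) : ℂ) ∈ Complex.slitPlane := by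
        right
        have h2 : (π / (-(π * Complex.I * t)) : ℂ) = ((t⁻¹ : ℝ) : ℂ) * Complex.I := by
          have h1 : (π : ℂ) ≠ 0 := by exact_mod_cast Real.pi_ne_zero
          have h2 : (t : ℂ) ≠ 0 := by exact_mod_cast ht
          have h3 := Complex.I_ne_zero
          push_cast
          field_simp
          simp
        rw [h2]
        simpa using ht
      exact ((tendsto_const_nhds.div hb hb0).cpow tendsto_const_nhds hslit)
    · refine tendsto_integral_filter_of_dominated_convergence (fun y => ‖h y‖) ?_ ?_
        h.integrable.norm ?_
      · refine Eventually.of_forall fun ε => Continuous.aestronglyMeasurable ?_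
        exact Continuous.mul (by fun_prop) h.continuous
      · filter_upwards [hre] with ε hε
        refine ae_of_all _ fun y => ?_
        rw [norm_mul]
        refine mul_le_of_le_one_left (norm_nonneg _) ?_
        rw [Complex.norm_exp, Real.exp_le_one_iff]
        have : -(π : ℂ) ^ 2 * ‖-ξ - y‖ ^ 2 / b ε =
            ((-(π ^ 2 * ‖-ξ - y‖ ^ 2) : ℝ) : ℂ) * (b ε)⁻¹ := by
          push_cast; ring
        rw [this, Complex.re_ofReal_mul, Complex.inv_re]
        exact mul_nonpos_of_nonpos_of_nonneg (by rw [neg_nonpos]; positivity)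
          (div_nonneg hε.le (Complex.normSq_nonneg _))
      · refine ae_of_all _ fun y => ?_
        refine Tendsto.mul_const _ ?_
        refine (Complex.continuous_exp.tendsto _).comp ?_
        exact tendsto_const_nhds.div hb hb0
  have heq : ∀ᶠ ε in 𝓝[>] (0 : ℝ),
      ∫ z, Complex.exp (-b ε * ‖z‖ ^ 2 + 2 * π * Complex.I * ⟪-ξ, z⟫) * 𝓕 h z =
      ∫ y, (π / b ε) ^ (finrank ℝ V / 2 : ℂ) * Complex.exp (-π ^ 2 * ‖-ξ - y‖ ^ 2 / b ε) * h y := by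
    filter_upwards [hre] with ε hε
    exact integral_gaussian_mul_fourier hε h ξ
  have key := tendsto_nhds_unique (hL.congr' heq) hR
  have hc := cpow_pi_div_neg_pi_mul_I ht ((finrank ℝ V : ℝ) / 2)
  push_cast at hc
  rw [hc] at key
  rw [SchwartzMap.fourier_coe, Real.fourier_eq']
  convert key using 1
  · refine integral_congr_ae (ae_of_all _ fun z => ?_)
    simp only [chirpMul_apply, smul_eq_mul]
    unfold chirp
    rw [← mul_assoc, ← Complex.exp_add]
    congr 2
    rw [inner_neg_left, real_inner_comm]
    push_cast
    ring
  · congr 1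
    · congr 1
      · congr 1
        push_cast
        ring
      · rw [neg_div]
    · refine integral_congr_ae (ae_of_all _ fun y => ?_)
      simp only
      congr 2
      rw [show -ξ - y = -(ξ + y) by abel, norm_neg]
      have h1 : (π : ℂ) ≠ 0 := by exact_mod_cast Real.pi_ne_zero
      have h2 : (t : ℂ) ≠ 0 := by exact_mod_cast ht
      have h3 := Complex.I_ne_zero
      push_cast
      field_simp
      simp

omit [FiniteDimensional ℝ V] [MeasurableSpace V] [BorelSpace V] in
theorem chirpMul_zero (f : 𝓢(V, ℂ)) : chirpMul 0 f = f := by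
  ext x; simp [chirpMul_apply, chirp]

theorem fourier_fourier_apply (f : 𝓢(V, ℂ)) (x : V) : 𝓕 (𝓕 f) x = f (-x) := by
  have h1 := DFunLike.congr_fun (SchwartzMap.fourierInv_apply_eq (𝓕 f)) (-x)
  rw [FourierTransform.fourierInv_fourier_eq] at h1
  rw [h1]
  simp

/-- The integral operator of `S` composed with the action of a matrix of `SL(2, ℝ)`. -/
theorem integral_exp_mul_weilV {a b c d : ℝ} (h : a * d - b * c = 1) (f : 𝓢(V, ℂ)) (x : V) :
    ∫ y, Complex.exp (π * Complex.I * (-2 * ⟪x, y⟫ : ℝ)) * weilV a b c d f y =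
      Complex.exp (Complex.I * π * (finrank ℝ V : ℝ) * (Real.sign (a * c) : ℝ) / 4) *
        weilV (-c) (-d) a b f x := by
  by_cases hc : c = 0
  · subst hc
    have ha : a ≠ 0 := by rintro rfl; simp at h
    have hpow : |a| ^ ((finrank ℝ V : ℝ) / 2) * |(a ^ finrank ℝ V)⁻¹| =
        |a| ^ (-(finrank ℝ V : ℝ) / 2) := by
      rw [abs_inv, abs_pow, ← Real.rpow_natCast, ← Real.rpow_neg (abs_nonneg a),
        ← Real.rpow_add (abs_pos.mpr ha)]
      congr 1; ring
    have hcs := Measure.integral_comp_smul (volume : Measure V)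
      (fun y => Complex.exp (π * Complex.I * ((b * ‖y‖ ^ 2 - 2 * ⟪x, y⟫) / a : ℝ)) * f y) a
    simp only [weilV, if_neg ha, if_true, mul_zero, Real.sign_zero, Complex.ofReal_zero, zero_div,
      Complex.exp_zero, one_mul, neg_zero, zero_mul, zero_add]
    rw [← hpow, Complex.ofReal_mul, mul_assoc, ← Complex.real_smul (x := |(a ^ finrank ℝ V)⁻¹|),
      ← hcs, ← integral_const_mul]
    refine integral_congr_ae (ae_of_all _ fun y => ?_)
    simp only
    rw [mul_left_comm, mul_assoc (Complex.ofReal _) (Complex.exp _) _, mul_left_comm (Complex.exp _),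
      ← mul_assoc (Complex.exp _), ← Complex.exp_add, inner_smul_right, norm_smul, mul_pow,
      Real.norm_eq_abs, sq_abs]
    have ha' : (a : ℂ) ≠ 0 := by exact_mod_cast ha
    congr 3
    push_cast
    field_simp
    ring
  · have hc' : (c : ℂ) ≠ 0 := by exact_mod_cast hc
    set N := finrank ℝ V with hN
    -- After rescaling by $c^{-1}$ the chirp parameter $a/c$ becomes $ac$, and the integral is a
    -- Fourier transform evaluated at $cx$.
    let g : V → ℂ := fun z => Complex.exp (((-2 * π * ⟪z, c • x⟫ : ℝ) : ℂ) * Complex.I) •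
      chirpMul (a * c) (𝓕 (chirpMul (d / c) f)) z
    have h1 : ∫ y, Complex.exp (π * Complex.I * (-2 * ⟪x, y⟫ : ℝ)) * weilV a b c d f y =
        ((|c| ^ (-(N : ℝ) / 2) : ℝ) : ℂ) * ∫ y, g (c⁻¹ • y) := by
      rw [← integral_const_mul]
      refine integral_congr_ae (ae_of_all _ fun y => ?_)
      simp only [g]
      rw [weilV_of_ne_zero hc, chirpMul_apply, smul_eq_mul, mul_left_comm]
      congr 1
      unfold chirp
      rw [← mul_assoc, ← mul_assoc, ← Complex.exp_add, ← Complex.exp_add]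
      congr 2
      rw [inner_smul_left, inner_smul_right, real_inner_comm, norm_smul, mul_pow,
        Real.norm_eq_abs, sq_abs]
      simp only [conj_trivial]
      push_cast
      field_simp
    have h2 : ∫ z, g z = 𝓕 (chirpMul (a * c) (𝓕 (chirpMul (d / c) f))) (c • x) := by
      rw [SchwartzMap.fourier_coe, Real.fourier_eq']
    have h3 : ∫ y, g (c⁻¹ • y) = ((|c| ^ (N : ℝ) : ℝ) : ℂ) * ∫ z, g z := by
      rw [Measure.integral_comp_smul, Complex.real_smul]
      congr 2
      rw [inv_pow, inv_inv, abs_pow, Real.rpow_natCast]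
    rw [h1, h3, h2, ← mul_assoc, ← Complex.ofReal_mul, ← Real.rpow_add (abs_pos.mpr hc)]
    -- If $a=0$ the chirp disappears and two Fourier transforms give a reflection without phase;
    -- otherwise the chirp formula with $t=ac$ supplies $\mathrm{sign}(ac)$.
    by_cases ha : a = 0
    · subst ha
      rw [zero_mul, chirpMul_zero, fourier_fourier_apply, chirpMul_apply, weilV, if_pos rfl]
      simp only [Real.sign_zero, Complex.ofReal_zero, mul_zero, zero_div, Complex.exp_zero, one_mul]
      rw [abs_neg, ← hN, mul_assoc]
      unfold chirp
      congr 2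
      · congr 1; ring
      · congr 2
        rw [norm_neg, norm_smul, mul_pow, Real.norm_eq_abs, sq_abs]
        field_simp
      · rw [neg_smul]
    · rw [fourier_chirp_mul_fourier (mul_ne_zero ha hc), ← hN, weilV, if_neg ha, ← hN]
      have hpow : |c| ^ (-(N : ℝ) / 2 + N) * |a * c| ^ (-(N : ℝ) / 2) = |a| ^ (-(N : ℝ) / 2) := by
        rw [abs_mul, Real.mul_rpow (abs_nonneg _) (abs_nonneg _), mul_left_comm,
          ← Real.rpow_add (abs_pos.mpr hc)]
        ring_nf
        simp
      rw [← hpow, Complex.ofReal_mul]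
      -- Expanding the square leaves $\|y\|^2$ with coefficient $d/c-1/(ac)$, which is $b/a$ because
      -- $ad-bc=1$.
      have e : ∫ y, Complex.exp (π * Complex.I * (-(‖c • x + y‖ ^ 2) / (a * c) : ℝ)) *
            chirpMul (d / c) f y =
          ∫ y, Complex.exp (π * Complex.I *
            ((-c * ‖x‖ ^ 2 + b * ‖y‖ ^ 2 - 2 * ⟪x, y⟫) / a : ℝ)) * f y := by
        refine integral_congr_ae (ae_of_all _ fun y => ?_)
        simp only [chirpMul_apply]
        unfold chirp
        rw [← mul_assoc, ← Complex.exp_add, ← mul_add, ← Complex.ofReal_add]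
        congr 4
        rw [norm_add_sq_real, inner_smul_left, norm_smul, mul_pow, Real.norm_eq_abs, sq_abs]
        simp only [conj_trivial]
        field_simp
        linear_combination (‖y‖ ^ 2) * h
      rw [e]
      ring

end Weil

/-! ### Transfer between matrices, vectors and the Euclidean space of `M` -/

section Transfer

open scoped RealInnerProductSpace Kronecker

variable {m n : ℕ}

/-- Both volumes are Haar measures, hence proportional; evaluating them on the unit cube shows that
the constant is 1. -/
theorem measurePreserving_uncurry {ι κ : Type*} [Fintype ι] [Fintype κ] :
    MeasurePreserving (Function.uncurry : (ι → κ → ℝ) → (ι × κ → ℝ)) volume volume := by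
  let e : (ι × κ → ℝ) ≃L[ℝ] (ι → κ → ℝ) := (LinearEquiv.curry ℝ ℝ ι κ).toContinuousLinearEquiv
  have h1 : (Measure.map e volume) = (volume : Measure (ι → κ → ℝ)) := by
    have : (Measure.map e (volume : Measure (ι × κ → ℝ))).IsAddHaarMeasure :=
      e.isAddHaarMeasure_map _
    have : (volume : Measure (ι → κ → ℝ)).IsAddHaarMeasure := by
      have : ∀ i, ((fun _ => volume : ι → Measure (κ → ℝ)) i).IsAddHaarMeasure := fun _ =>
        inferInstanceAs (volume : Measure (κ → ℝ)).IsAddHaarMeasure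
      exact Measure.pi.isAddHaarMeasure (fun _ => volume : ι → Measure (κ → ℝ))
    have h2 := Measure.isAddLeftInvariant_eq_smul (Measure.map e volume)
      (volume : Measure (ι → κ → ℝ))
    have h3 : (Measure.map e volume)
        (Set.pi univ fun _ : ι => Set.pi univ fun _ : κ => Ioc (0 : ℝ) 1) = 1 := by
      rw [Measure.map_apply e.continuous.measurable
        (MeasurableSet.univ_pi fun _ => MeasurableSet.univ_pi fun _ => measurableSet_Ioc)]
      have : e ⁻¹' (Set.pi univ fun _ : ι => Set.pi univ fun _ : κ => Ioc (0 : ℝ) 1) =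
          Set.pi univ fun _ : ι × κ => Ioc (0 : ℝ) 1 := by
        ext x
        simp only [mem_preimage, Set.mem_pi, mem_univ, true_imp_iff, Prod.forall]
        rfl
      rw [this, Real.volume_pi_Ioc]
      simp
    rw [h2, Measure.smul_apply, volume_pi_pi] at h3
    simp only [Real.volume_pi_Ioc] at h3
    simp only [sub_zero, ENNReal.ofReal_one, Finset.prod_const_one] at h3
    rw [ENNReal.smul_def, smul_eq_mul, mul_one] at h3
    rw [h2, ENNReal.coe_eq_one.mp h3, one_smul]
  have h4 : MeasurePreserving e volume volume := ⟨e.continuous.measurable, h1⟩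
  exact h4.symm e.toHomeomorph.toMeasurableEquiv

/-- The linear equivalence from matrices to a Euclidean space given by left multiplication with an
invertible matrix. -/
noncomputable def mulEquiv (A : Matrix (Fin m) (Fin m) ℝ) (hA : IsUnit A.det) :
    (Fin m → Fin n → ℝ) ≃L[ℝ] EuclideanSpace ℝ (Fin m × Fin n) :=
  LinearEquiv.toContinuousLinearEquiv
    { toFun := fun x => WithLp.toLp 2 fun p => (A * Matrix.of x) p.1 p.2
      invFun := fun y => Matrix.of.symm (A⁻¹ * Matrix.of fun i j => y (i, j))
      map_add' := fun x y => by
        ext p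
        simp [← Matrix.of_add_of, Matrix.mul_add]
      map_smul' := fun r x => by
        ext p
        simp [← Matrix.smul_of]
      left_inv := fun x => by
        have : (Matrix.of fun i j => (A * Matrix.of x) i j) = A * Matrix.of x := rfl
        simp only [this]
        rw [← Matrix.mul_assoc, Matrix.nonsing_inv_mul A hA, Matrix.one_mul]
        rfl
      right_inv := fun y => by
        ext p
        simp only [Equiv.apply_symm_apply]
        rw [← Matrix.mul_assoc, Matrix.mul_nonsing_inv A hA, Matrix.one_mul]
        rfl }

theorem mulEquiv_apply (A : Matrix (Fin m) (Fin m) ℝ) (hA : IsUnit A.det)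
    (x : Fin m → Fin n → ℝ) (p : Fin m × Fin n) :
    mulEquiv A hA x p = (A * Matrix.of x) p.1 p.2 := rfl

theorem inner_mulEquiv (A : Matrix (Fin m) (Fin m) ℝ) (hA : IsUnit A.det)
    (x y : Fin m → Fin n → ℝ) :
    ⟪mulEquiv A hA x, mulEquiv A hA y⟫ = bil (Aᵀ * A) (Matrix.of x) (Matrix.of y) := by
  have h : (Matrix.of x)ᵀ * (Aᵀ * A) * Matrix.of y = (A * Matrix.of x)ᵀ * (A * Matrix.of y) := by
    rw [Matrix.transpose_mul]; simp only [Matrix.mul_assoc]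
  rw [bil, h, PiLp.inner_apply, Matrix.trace, Fintype.sum_prod_type_right]
  refine Finset.sum_congr rfl fun j _ => ?_
  rw [Matrix.diag_apply, Matrix.mul_apply]
  refine Finset.sum_congr rfl fun i _ => ?_
  simp [mulEquiv_apply, mul_comm]

theorem norm_sq_mulEquiv (A : Matrix (Fin m) (Fin m) ℝ) (hA : IsUnit A.det)
    (x : Fin m → Fin n → ℝ) :
    ‖mulEquiv A hA x‖ ^ 2 = bil (Aᵀ * A) (Matrix.of x) (Matrix.of x) := by
  rw [← real_inner_self_eq_norm_sq, inner_mulEquiv]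

/-- On flattened matrices, left multiplication by $A$ is $A\otimes 1_n$, with determinant $(\det
A)^n$. -/
theorem map_mulEquiv_volume (A : Matrix (Fin m) (Fin m) ℝ) (hA : IsUnit A.det) :
    Measure.map (mulEquiv (n := n) A hA) volume = ENNReal.ofReal ((|A.det| ^ n)⁻¹) • volume := by
  have hdet : (A ⊗ₖ (1 : Matrix (Fin n) (Fin n) ℝ)).det = A.det ^ n := by
    rw [Matrix.det_kronecker]; simp
  have hcomp : (mulEquiv (n := n) A hA : (Fin m → Fin n → ℝ) → EuclideanSpace ℝ (Fin m × Fin n)) =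
      WithLp.toLp 2 ∘ Matrix.toLin' (A ⊗ₖ (1 : Matrix (Fin n) (Fin n) ℝ)) ∘ Function.uncurry := by
    ext x p
    simp [mulEquiv_apply, Matrix.mulVec, dotProduct, Matrix.mul_apply, Fintype.sum_prod_type,
      Matrix.one_apply]
  have hm := (LinearMap.continuous_on_pi
    (Matrix.toLin' (A ⊗ₖ (1 : Matrix (Fin n) (Fin n) ℝ)))).measurable
  have hu := measurePreserving_uncurry (ι := Fin m) (κ := Fin n)
  have ht := PiLp.volume_preserving_toLp (Fin m × Fin n)
  rw [hcomp, ← Measure.map_map ht.measurable (hm.comp hu.measurable),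
    ← Measure.map_map hm hu.measurable, hu.map_eq,
    Real.map_matrix_volume_pi_eq_smul_volume_pi (by rw [hdet]; exact pow_ne_zero _ hA.ne_zero),
    Measure.map_smul, ht.map_eq, hdet, abs_inv, abs_pow]

theorem integral_comp_mulEquiv (A : Matrix (Fin m) (Fin m) ℝ) (hA : IsUnit A.det)
    (F : EuclideanSpace ℝ (Fin m × Fin n) → ℂ) :
    ∫ x, F (mulEquiv A hA x) = (((|A.det| ^ n)⁻¹ : ℝ) : ℂ) * ∫ y, F y := by
  have h := integral_map_equiv (μ := volume)
    (mulEquiv (n := n) A hA).toHomeomorph.toMeasurableEquiv F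
  have h2 : ((mulEquiv (n := n) A hA).toHomeomorph.toMeasurableEquiv :
    (Fin m → Fin n → ℝ) → EuclideanSpace ℝ (Fin m × Fin n)) = mulEquiv A hA := rfl
  rw [h2, map_mulEquiv_volume, integral_smul_measure, ENNReal.toReal_ofReal (by positivity),
    Complex.real_smul] at h
  exact h.symm

/-- The Schwartz function on the Euclidean space corresponding to one on matrices. -/
noncomputable def toEuclid (A : Matrix (Fin m) (Fin m) ℝ) (hA : IsUnit A.det)
    (f : 𝓢(Fin m → Fin n → ℝ, ℂ)) : 𝓢(EuclideanSpace ℝ (Fin m × Fin n), ℂ) :=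
  SchwartzMap.compCLMOfContinuousLinearEquiv ℂ (mulEquiv A hA).symm f

theorem toEuclid_mulEquiv (A : Matrix (Fin m) (Fin m) ℝ) (hA : IsUnit A.det)
    (f : 𝓢(Fin m → Fin n → ℝ, ℂ)) (x : Fin m → Fin n → ℝ) :
    toEuclid A hA f (mulEquiv A hA x) = f x := by
  simp [toEuclid]

/-- The map $x\mapsto Ax$ turns $(\cdot,\cdot)_{\mathcal M}$ into the Euclidean inner product, and
its Jacobian $|\det A|^n=(\det\mathcal M)^{n/2}$ is exactly the normalising factor in `weil`. -/
theorem weil_eq_weilV (A : Matrix (Fin m) (Fin m) ℝ) (hA : IsUnit A.det) (g : SL2R)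
    (f : 𝓢(Fin m → Fin n → ℝ, ℂ)) (x : Fin m → Fin n → ℝ) :
    weil (Aᵀ * A) g (onMat f) (Matrix.of x) =
      weilV (g.1 0 0) (g.1 0 1) (g.1 1 0) (g.1 1 1) (toEuclid A hA f) (mulEquiv A hA x) := by
  have hfr : ((Module.finrank ℝ (EuclideanSpace ℝ (Fin m × Fin n)) : ℕ) : ℝ) = m * n := by
    simp
  unfold weil weilV
  rw [hfr]
  simp only
  by_cases hc : g.1 1 0 = 0
  · rw [if_pos hc, if_pos hc, norm_sq_mulEquiv]
    congr 1
    exact (toEuclid_mulEquiv A hA f (g.1 0 0 • x)).symm.trans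
      (congrArg _ (map_smul (mulEquiv A hA) (g.1 0 0) x))
  · rw [if_neg hc, if_neg hc]
    have h := integral_comp_mulEquiv A hA fun y => Complex.exp (π * Complex.I *
        ((g.1 0 0 * ‖mulEquiv A hA x‖ ^ 2 + g.1 1 1 * ‖y‖ ^ 2 -
          2 * ⟪mulEquiv A hA x, y⟫) / g.1 1 0 : ℝ)) * toEuclid A hA f y
    simp only [norm_sq_mulEquiv, inner_mulEquiv, toEuclid_mulEquiv] at h
    simp only [norm_sq_mulEquiv]
    change _ * ∫ y, _ * f y = _
    rw [h, ← mul_assoc]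
    congr 1
    have hd : (Aᵀ * A).det ^ ((n : ℝ) / 2) = |A.det| ^ n := by
      rw [Matrix.det_mul, Matrix.det_transpose, ← abs_mul_abs_self, ← sq, ← Real.rpow_natCast,
        ← Real.rpow_mul (abs_nonneg _), ← Real.rpow_natCast]
      congr 1; push_cast; ring
    have hp : |A.det| ^ n ≠ 0 := pow_ne_zero _ (abs_ne_zero.mpr hA.ne_zero)
    rw [hd, ← Complex.ofReal_mul]
    congr 1
    field_simp

theorem exists_eq_transpose_mul_self {M : RMat m m} (hM : M.PosDef) :
    ∃ A : Matrix (Fin m) (Fin m) ℝ, IsUnit A.det ∧ M = Aᵀ * A := by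
  open scoped MatrixOrder in
  obtain ⟨B, hB⟩ := CStarAlgebra.nonneg_iff_eq_star_mul_self.mp hM.posSemidef.nonneg
  refine ⟨B, ?_, hB⟩
  have h := hM.det_pos
  rw [hB, Matrix.det_mul] at h
  exact isUnit_iff_ne_zero.mpr (right_ne_zero_of_mul h.ne')

theorem exists_schwartz_eq_weil {M : RMat m m} (hM : M.PosDef) (g : SL2R)
    (f : 𝓢(Fin m → Fin n → ℝ, ℂ)) :
    ∃ W : 𝓢(Fin m → Fin n → ℝ, ℂ), weil M g (onMat f) = onMat W := by
  obtain ⟨A, hA, rfl⟩ := exists_eq_transpose_mul_self hM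
  have hdet := g.2
  rw [Matrix.det_fin_two] at hdet
  obtain ⟨F, hF⟩ := exists_schwartz_eq_weilV hdet (toEuclid A hA f)
  refine ⟨SchwartzMap.compCLMOfContinuousLinearEquiv ℂ (mulEquiv A hA) F, ?_⟩
  ext x
  have := weil_eq_weilV A hA g f (Matrix.of.symm x)
  rw [hF] at this
  exact this

/-! ### Sums over integral matrices -/

/-- Integral matrices as integral vectors. -/
def zmatEquiv : (Fin m × Fin n → ℤ) ≃ ZMat m n :=
  (Equiv.curry (Fin m) (Fin n) ℤ).trans Matrix.of

theorem norm_le_norm_curry {ι κ : Type*} [Fintype ι] [Fintype κ] (x : ι × κ → ℝ) :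
    ‖x‖ ≤ ‖Function.curry x‖ :=
  (pi_norm_le_iff_of_nonneg (norm_nonneg _)).mpr fun p =>
    (norm_le_pi_norm (Function.curry x p.1) p.2).trans (norm_le_pi_norm (Function.curry x) p.1)

theorem exists_decay (W : 𝓢(Fin m → Fin n → ℝ, ℂ)) (r : ℕ) :
    ∃ C : ℝ, ∀ x, ‖W x‖ ≤ C * (1 + ‖x‖) ^ (-(r : ℝ)) := by
  refine ⟨2 ^ r * (Finset.Iic (r, 0)).sup (fun k => SchwartzMap.seminorm ℝ k.1 k.2) W,
    fun x => ?_⟩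
  have := SchwartzMap.one_add_le_sup_seminorm_apply (𝕜 := ℝ) (m := (r, 0)) le_rfl le_rfl W x
  rw [norm_iteratedFDeriv_zero] at this
  rw [Real.rpow_neg (by positivity), Real.rpow_natCast, ← div_eq_mul_inv,
    le_div_iff₀ (by positivity), mul_comm]
  exact this

theorem decay_comp_curry {G : (Fin m → Fin n → ℝ) → ℂ} {C r : ℝ} (hr : 0 ≤ r)
    (hG : ∀ x, ‖G x‖ ≤ C * (1 + ‖x‖) ^ (-r)) (x : Fin m × Fin n → ℝ) :
    ‖G (Function.curry x)‖ ≤ C * (1 + ‖x‖) ^ (-r) := by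
  have hC : 0 ≤ C := by simpa using (norm_nonneg _).trans (hG 0)
  refine (hG _).trans ?_
  refine mul_le_mul_of_nonneg_left ?_ hC
  exact Real.rpow_le_rpow_of_nonpos (by positivity) (by linarith [norm_le_norm_curry x])
    (by linarith)

theorem continuous_curry_pi :
    Continuous (Function.curry : (Fin m × Fin n → ℝ) → Fin m → Fin n → ℝ) :=
  continuous_pi fun i => continuous_pi fun j => continuous_apply (i, j)

theorem summable_onMat_toReal_add (W : 𝓢(Fin m → Fin n → ℝ, ℂ)) (x : RMat m n) :
    Summable fun ω : ZMat m n => onMat W (toReal ω + x) := by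
  -- The exponent $mn+1$ only has to exceed the dimension $mn$.
  obtain ⟨C, hC⟩ := exists_decay W (m * n + 1)
  have h := summable_comp_castVec_of_decay (ι := Fin m × Fin n)
    (f := fun y => W (Function.curry y)) (C := C) (r := ((m * n + 1 : ℕ) : ℝ)) (by simp)
    (decay_comp_curry (by positivity) hC) (Function.uncurry (Matrix.of.symm x))
  rw [← zmatEquiv.summable_iff]
  refine h.congr fun k => ?_
  simp only [Function.comp_apply, onMat]
  congr 1
  ext i j
  simp [zmatEquiv, castVec, toReal, Function.curry, add_comm]

/-- **Poisson summation** over integral matrices. -/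
theorem tsum_toReal_eq_tsum_integral {G : (Fin m → Fin n → ℝ) → ℂ} (hc : Continuous G) {C r : ℝ}
    (hr : (m * n : ℝ) < r) (hG : ∀ x, ‖G x‖ ≤ C * (1 + ‖x‖) ^ (-r))
    (hs : Summable fun ω : ZMat m n => ∫ y : Fin m → Fin n → ℝ,
      Complex.exp (π * Complex.I * (-2 * ((toReal ω)ᵀ * Matrix.of y).trace : ℝ)) * G y) :
    ∑' ω : ZMat m n, G (Matrix.of.symm (toReal ω)) =
      ∑' ω : ZMat m n, ∫ y : Fin m → Fin n → ℝ,
        Complex.exp (π * Complex.I * (-2 * ((toReal ω)ᵀ * Matrix.of y).trace : ℝ)) * G y := by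
  have hr0 : 0 ≤ r := (by positivity : (0 : ℝ) ≤ m * n).trans hr.le
  have key : ∀ k : Fin m × Fin n → ℤ, ∫ x, expChar k x * G (Function.curry x) =
      ∫ y : Fin m → Fin n → ℝ, Complex.exp (π * Complex.I *
        (-2 * ((toReal (zmatEquiv k))ᵀ * Matrix.of y).trace : ℝ)) * G y := by
    intro k
    have hu := measurePreserving_uncurry (ι := Fin m) (κ := Fin n)
    have he : MeasurableEmbedding
        (Function.uncurry : (Fin m → Fin n → ℝ) → (Fin m × Fin n → ℝ)) :=
      ((LinearEquiv.curry ℝ ℝ (Fin m) (Fin n)).symm.toContinuousLinearEquiv.toHomeomorph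
        ).measurableEmbedding
    rw [← hu.integral_comp he]
    refine integral_congr_ae (ae_of_all _ fun y => ?_)
    simp only [Function.curry_uncurry, expChar]
    congr 2
    have : ∑ i, (k i : ℝ) * Function.uncurry y i =
        ((toReal (zmatEquiv k))ᵀ * Matrix.of y).trace := by
      rw [Matrix.trace, Fintype.sum_prod_type_right]
      refine Finset.sum_congr rfl fun j _ => ?_
      rw [Matrix.diag_apply, Matrix.mul_apply]
      rfl
    rw [this]
    push_cast
    ring
  rw [← zmatEquiv.tsum_eq, ← zmatEquiv.tsum_eq (fun ω : ZMat m n => ∫ y : Fin m → Fin n → ℝ, _)]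
  simp only [← key]
  rw [← zmatEquiv.summable_iff] at hs
  refine tsum_castVec_eq_tsum_fourier (hc.comp continuous_curry_pi) (C := C) (r := r) (by simpa)
    (decay_comp_curry hr0 hG) (hs.congr fun k => ?_)
  exact (key k).symm

end Transfer

variable {m n : ℕ}

/-! ### The bilinear form -/

section Bilinear

variable (M : RMat m m)

theorem bil_add_left (x y z : RMat m n) : bil M (x + y) z = bil M x z + bil M y z := by
  simp [bil, Matrix.add_mul]

theorem bil_add_right (x y z : RMat m n) : bil M x (y + z) = bil M x y + bil M x z := by
  simp [bil, Matrix.mul_add]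

theorem bil_neg_left (x y : RMat m n) : bil M (-x) y = -bil M x y := by
  simp [bil]

theorem bil_neg_right (x y : RMat m n) : bil M x (-y) = -bil M x y := by
  simp [bil]

theorem bil_sub_left (x y z : RMat m n) : bil M (x - y) z = bil M x z - bil M y z := by
  rw [sub_eq_add_neg, bil_add_left, bil_neg_left, sub_eq_add_neg]

theorem bil_sub_right (x y z : RMat m n) : bil M x (y - z) = bil M x y - bil M x z := by
  rw [sub_eq_add_neg, bil_add_right, bil_neg_right, sub_eq_add_neg]

theorem bil_smul_left (r : ℝ) (x y : RMat m n) : bil M (r • x) y = r * bil M x y := by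
  simp [bil]

theorem bil_smul_right (r : ℝ) (x y : RMat m n) : bil M x (r • y) = r * bil M x y := by
  simp [bil]

theorem trace_mul_mul_transpose (x y : RMat m n) : (M * (x * yᵀ)).trace = bil M y x := by
  rw [bil, ← Matrix.mul_assoc, Matrix.trace_mul_comm, Matrix.mul_assoc]

variable {M}

theorem bil_comm (hM : M.IsSymm) (x y : RMat m n) : bil M x y = bil M y x := by
  rw [bil, bil, ← Matrix.trace_transpose]
  simp only [Matrix.transpose_mul, Matrix.transpose_transpose, hM.eq, Matrix.mul_assoc]

theorem toReal_mul {k : ℕ} (A : ZMat m k) (B : ZMat k n) :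
    toReal (A * B) = toReal A * toReal B := by
  ext i j
  simp [toReal, Matrix.mul_apply]

theorem toReal_add (A B : ZMat m n) : toReal (A + B) = toReal A + toReal B := by
  ext i j
  simp [toReal]

theorem exists_int_bil_toReal (M : ZMat m m) (a b : ZMat m n) :
    ∃ k : ℤ, bil (toReal M) (toReal a) (toReal b) = k := by
  refine ⟨(aᵀ * M * b).trace, ?_⟩
  have : (toReal a)ᵀ = toReal aᵀ := rfl
  rw [bil, this, ← toReal_mul, ← toReal_mul]
  simp [Matrix.trace, toReal]

theorem exp_pi_mul_I_two_mul_int (k : ℤ) :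
    Complex.exp (π * Complex.I * ((2 * (k : ℝ) : ℝ) : ℂ)) = 1 := by
  rw [← Complex.exp_int_mul_two_pi_mul_I k]
  congr 1
  push_cast
  ring

theorem exp_pi_mul_I_add (a b : ℝ) :
    Complex.exp (π * Complex.I * ((a + b : ℝ) : ℂ)) =
      Complex.exp (π * Complex.I * (a : ℂ)) * Complex.exp (π * Complex.I * (b : ℂ)) := by
  rw [← Complex.exp_add]
  push_cast
  ring_nf

theorem norm_exp_pi_mul_I (a : ℝ) : ‖Complex.exp (π * Complex.I * (a : ℂ))‖ = 1 := by
  rw [Complex.norm_exp]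
  simp

theorem schrodinger_eq (M : RMat m m) (h : Heis m n) (F : RMat m n → ℂ) (x : RMat m n) :
    schrodinger M h F x = Complex.exp (π * Complex.I *
      (((M * h.kap).trace + bil M h.lam h.mu + 2 * bil M h.mu x : ℝ) : ℂ)) * F (x + h.lam) := by
  rw [schrodinger]
  congr 3
  rw [Matrix.mul_add, Matrix.mul_add, Matrix.trace_add, Matrix.trace_add, trace_mul_mul_transpose,
    Matrix.mul_smul, Matrix.trace_smul, trace_mul_mul_transpose, smul_eq_mul]

theorem isSymm_of_posDef (hM : M.PosDef) : M.IsSymm := by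
  have := hM.isHermitian
  rwa [Matrix.IsHermitian, Matrix.conjTranspose_eq_transpose_of_trivial] at this

end Bilinear

/-! ### Summability of the theta series -/

section Theta

theorem summable_thetaTerm {M : RMat m m} (hM : M.PosDef) (f : 𝓢(Fin m → Fin n → ℝ, ℂ)) (τ : ℍ)
    (φ : ℝ) (h : Heis m n) : Summable (thetaTerm M f τ φ h) := by
  obtain ⟨W, hW⟩ := exists_schwartz_eq_weil hM (iwasawa τ φ) f
  refine Summable.of_norm ((summable_onMat_toReal_add W h.lam).norm.congr fun ω => ?_)
  rw [thetaTerm, jacobiRep, schrodinger_eq, norm_mul, norm_exp_pi_mul_I, one_mul, hW]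

/-! ### The Iwasawa coordinates -/

theorem iwasawa_coe (τ : ℍ) (φ : ℝ) :
    (iwasawa τ φ).1 = !![√τ.im * Real.cos φ + τ.re * (√τ.im)⁻¹ * Real.sin φ,
      -(√τ.im * Real.sin φ) + τ.re * (√τ.im)⁻¹ * Real.cos φ;
      (√τ.im)⁻¹ * Real.sin φ, (√τ.im)⁻¹ * Real.cos φ] := by
  change (unip τ.re).1 * (diagEl τ.im τ.im_pos).1 * (rot φ).1 = _
  ext i j
  fin_cases i <;> fin_cases j <;>
    simp [unip, diagEl, rot]

theorem matS_mul_coe (g : SL2R) :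
    (matS * g).1 = !![-g.1 1 0, -g.1 1 1; g.1 0 0, g.1 0 1] := by
  change matS.1 * g.1 = _
  ext i j
  fin_cases i <;> fin_cases j <;>
    simp [matS, Matrix.mul_apply, Fin.sum_univ_two]

theorem unip_mul_coe (t : ℝ) (g : SL2R) :
    (unip t * g).1 = !![g.1 0 0 + t * g.1 1 0, g.1 0 1 + t * g.1 1 1; g.1 1 0, g.1 1 1] := by
  change (unip t).1 * g.1 = _
  ext i j
  fin_cases i <;> fin_cases j <;>
    simp [unip, Matrix.mul_apply, Fin.sum_univ_two]

theorem diagEl_mul_coe (v : ℝ) (hv : 0 < v) (g : SL2R) :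
    (diagEl v hv * g).1 =
      !![√v * g.1 0 0, √v * g.1 0 1; (√v)⁻¹ * g.1 1 0, (√v)⁻¹ * g.1 1 1] := by
  change (diagEl v hv).1 * g.1 = _
  ext i j
  fin_cases i <;> fin_cases j <;>
    simp [diagEl, Matrix.mul_apply, Fin.sum_univ_two]

/-- With $r=|\tau|$ one has $\mathrm{Im}(-1/\tau)=v/r^2$, $\cos\arg\tau=u/r$ and $\sin\arg\tau=v/r$;
the addition formulas and $r^2=u^2+v^2$ then match the entries. -/
theorem iwasawa_negInv (τ : ℍ) (φ : ℝ) :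
    iwasawa (negInv τ) (φ + Complex.arg τ) = matS * iwasawa τ φ := by
  have hτ : (τ : ℂ) ≠ 0 := τ.ne_zero
  set r := ‖(τ : ℂ)‖ with hr
  have hr0 : 0 < r := norm_pos_iff.mpr hτ
  have hv := τ.im_pos
  have hsq : r ^ 2 = τ.re ^ 2 + τ.im ^ 2 := by
    rw [hr, Complex.sq_norm, Complex.normSq_apply]
    simp [sq]
  have him : (negInv τ).im = τ.im / r ^ 2 := by
    change (-1 / (τ : ℂ)).im = _
    rw [hr, Complex.sq_norm, Complex.div_im]
    simp [neg_div]
  have hre : (negInv τ).re = -τ.re / r ^ 2 := by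
    change (-1 / (τ : ℂ)).re = _
    rw [hr, Complex.sq_norm, Complex.div_re]
    simp
  have hcos : Real.cos (Complex.arg τ) = τ.re / r := Complex.cos_arg hτ
  have hsin : Real.sin (Complex.arg τ) = τ.im / r := Complex.sin_arg τ
  have hsqrt : √(negInv τ).im = √τ.im / r := by
    rw [him, Real.sqrt_div hv.le, Real.sqrt_sq hr0.le]
  have hw : 0 < √τ.im := Real.sqrt_pos.mpr hv
  have hw2 : τ.im = √τ.im ^ 2 := (Real.sq_sqrt hv.le).symm
  apply Subtype.ext
  rw [matS_mul_coe, iwasawa_coe, iwasawa_coe, hsqrt, hre, Real.cos_add, Real.sin_add, hcos, hsin]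
  generalize √τ.im = w at *
  rw [hw2] at hsq ⊢
  ext i j
  fin_cases i <;> fin_cases j <;> simp <;> field_simp
  · linear_combination (Real.sin φ) * hsq
  · linear_combination (Real.cos φ) * hsq
  · ring
  · ring

theorem iwasawa_two_vadd (τ : ℍ) (φ : ℝ) :
    iwasawa ((2 : ℝ) +ᵥ τ) φ = unip 2 * iwasawa τ φ := by
  apply Subtype.ext
  rw [unip_mul_coe, iwasawa_coe, iwasawa_coe]
  ext i j
  fin_cases i <;> fin_cases j <;> simp <;> ring

theorem iwasawa_I (φ : ℝ) : iwasawa UpperHalfPlane.I φ = rot φ := by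
  apply Subtype.ext
  rw [iwasawa_coe]
  simp [rot]

/-! ### The Weil representation of upper triangular matrices and of `S` -/

/-- An upper triangular left factor has lower left entry 0, so the cocycle is trivial and the
projective representation is multiplicative here. -/
theorem weil_unip_mul (M : RMat m m) (t : ℝ) (g : SL2R) (F : RMat m n → ℂ) (x : RMat m n) :
    weil M (unip t * g) F x =
      Complex.exp (π * Complex.I * ((t * bil M x x : ℝ) : ℂ)) * weil M g F x := by
  have hdet := g.2
  rw [Matrix.det_fin_two] at hdet
  unfold weil
  simp only [unip_mul_coe, Matrix.of_apply, Matrix.cons_val', Matrix.cons_val_zero,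
    Matrix.cons_val_one, Matrix.cons_val_fin_one]
  by_cases hc : g.1 1 0 = 0
  · have e : (g.1 0 0 + t * g.1 1 0) * (g.1 0 1 + t * g.1 1 1) * bil M x x =
        t * bil M x x + g.1 0 0 * g.1 0 1 * bil M x x := by
      rw [hc] at hdet ⊢
      linear_combination (t * bil M x x) * hdet
    rw [if_pos hc, if_pos hc, e, exp_pi_mul_I_add, hc, mul_zero, add_zero]
    ring
  · rw [if_neg hc, if_neg hc, mul_left_comm]
    congr 1
    rw [← integral_const_mul]
    refine integral_congr_ae (ae_of_all _ fun y => ?_)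
    simp only
    rw [← mul_assoc, ← exp_pi_mul_I_add]
    congr 4
    field_simp
    ring

theorem weil_diagEl_mul (M : RMat m m) (v : ℝ) (hv : 0 < v) (g : SL2R) (F : RMat m n → ℂ)
    (x : RMat m n) :
    weil M (diagEl v hv * g) F x =
      ((v ^ ((m * n : ℝ) / 4) : ℝ) : ℂ) * weil M g F (√v • x) := by
  have hw : 0 < √v := Real.sqrt_pos.mpr hv
  have hw2 : √v ^ ((m * n : ℝ) / 2) = v ^ ((m * n : ℝ) / 4) := by
    rw [Real.sqrt_eq_rpow, ← Real.rpow_mul hv.le]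
    congr 1; ring
  unfold weil
  simp only [diagEl_mul_coe, Matrix.of_apply, Matrix.cons_val', Matrix.cons_val_zero,
    Matrix.cons_val_one, Matrix.cons_val_fin_one, bil_smul_left, bil_smul_right]
  by_cases hc : g.1 1 0 = 0
  · have e : √v * g.1 0 0 * (√v * g.1 0 1) * bil M x x =
        g.1 0 0 * g.1 0 1 * (√v * (√v * bil M x x)) := by ring
    rw [if_pos hc, if_pos (by rw [hc, mul_zero]), e, abs_mul, abs_of_pos hw,
      Real.mul_rpow hw.le (abs_nonneg _), hw2, smul_smul, mul_comm (√v) (g.1 0 0),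
      Complex.ofReal_mul]
    ring
  · rw [if_neg hc, if_neg (mul_ne_zero (inv_ne_zero hw.ne') hc), abs_mul, abs_inv, abs_of_pos hw,
      Real.mul_rpow (inv_nonneg.mpr hw.le) (abs_nonneg _), Real.inv_rpow hw.le, neg_div,
      Real.rpow_neg hw.le, inv_inv, hw2, mul_left_comm, Complex.ofReal_mul, mul_assoc]
    have e : ∀ y : Fin m → Fin n → ℝ, (√v * g.1 0 0 * bil M x x +
        (√v)⁻¹ * g.1 1 1 * bil M (Matrix.of y) (Matrix.of y) - 2 * bil M x (Matrix.of y)) /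
          ((√v)⁻¹ * g.1 1 0) = (g.1 0 0 * (√v * (√v * bil M x x)) +
        g.1 1 1 * bil M (Matrix.of y) (Matrix.of y) - 2 * (√v * bil M x (Matrix.of y))) /
          g.1 1 0 := fun y => by
      field_simp
    simp only [e]

/-- The integral is $R(S)$ without its factor $(\det\mathcal M)^{n/2}$, hence the negative power.
The cocycle involves $\mathrm{sign}(ac)$ because the lower left entries of $S$, $g$, $Sg$ are
$1,c,a$. -/
theorem integral_exp_mul_weil {M : RMat m m} (hM : M.PosDef) (g : SL2R)
    (f : 𝓢(Fin m → Fin n → ℝ, ℂ)) (x : RMat m n) :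
    ∫ y : Fin m → Fin n → ℝ, Complex.exp (π * Complex.I * ((-2 * bil M x (Matrix.of y) : ℝ) : ℂ)) *
        weil M g (onMat f) (Matrix.of y) =
      ((M.det ^ (-(n : ℝ) / 2) : ℝ) : ℂ) * (cocycle m n matS g)⁻¹ *
        weil M (matS * g) (onMat f) x := by
  obtain ⟨A, hA, rfl⟩ := exists_eq_transpose_mul_self hM
  have hdet := g.2
  rw [Matrix.det_fin_two] at hdet
  have h1 := integral_exp_mul_weilV hdet (toEuclid A hA f) (mulEquiv A hA (Matrix.of.symm x))
  have h2 := weil_eq_weilV A hA (matS * g) f (Matrix.of.symm x)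
  rw [matS_mul_coe] at h2
  simp only [Matrix.of_apply, Matrix.cons_val', Matrix.cons_val_zero,
    Matrix.cons_val_one, Matrix.cons_val_fin_one] at h2
  rw [← h2, Equiv.apply_symm_apply] at h1
  have h3 := integral_comp_mulEquiv A hA fun y => Complex.exp (π * Complex.I *
    ((-2 * inner ℝ (mulEquiv A hA (Matrix.of.symm x)) y : ℝ) : ℂ)) *
      weilV (g.1 0 0) (g.1 0 1) (g.1 1 0) (g.1 1 1) (toEuclid A hA f) y
  rw [h1] at h3
  simp only [← weil_eq_weilV, inner_mulEquiv, Equiv.apply_symm_apply] at h3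
  rw [h3, ← mul_assoc]
  congr 2
  · have hd : (Aᵀ * A).det ^ (-(n : ℝ) / 2) = (|A.det| ^ n)⁻¹ := by
      rw [Matrix.det_mul, Matrix.det_transpose, ← abs_mul_abs_self, ← sq, ← Real.rpow_natCast,
        ← Real.rpow_mul (abs_nonneg _), ← Real.rpow_natCast, ← Real.rpow_neg (abs_nonneg _)]
      congr 1; push_cast; ring
    rw [hd]
  · have hS : matS.1 1 0 = 1 := by simp [matS]
    have hS2 : (matS * g).1 1 0 = g.1 0 0 := by rw [matS_mul_coe]; simp
    have hfr : ((Module.finrank ℝ (EuclideanSpace ℝ (Fin m × Fin n)) : ℕ) : ℝ) = m * n := by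
      simp
    rw [cocycle, ← Complex.exp_neg, neg_neg, hS, hS2, hfr, one_mul, mul_comm (g.1 1 0),
      mul_comm Complex.I]

/-- The intertwining relation of the Fourier transform and the Schrödinger representation. -/
theorem integral_exp_mul_schrodinger {M : RMat m m} (hM : M.PosDef) (g : SL2R)
    (f : 𝓢(Fin m → Fin n → ℝ, ℂ)) (h : Heis m n) (x : RMat m n) :
    ∫ y : Fin m → Fin n → ℝ, Complex.exp (π * Complex.I * ((-2 * bil M x (Matrix.of y) : ℝ) : ℂ)) *
        schrodinger M h (weil M g (onMat f)) (Matrix.of y) =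
      ((M.det ^ (-(n : ℝ) / 2) : ℝ) : ℂ) * (cocycle m n matS g)⁻¹ *
        schrodinger M ⟨-h.mu, h.lam, h.kap, h.isSymm_inversion⟩ (weil M (matS * g) (onMat f)) x := by
  have hs := isSymm_of_posDef hM
  have h1 := integral_exp_mul_weil hM g f (x - h.mu)
  -- Translation invariance removes $\lambda$ from the argument; the linear phase in $\mu$ then
  -- merges with the Fourier kernel and shifts the frequency to $x-\mu$.
  let H : (Fin m → Fin n → ℝ) → ℂ := fun y =>
    Complex.exp (π * Complex.I * ((-2 * bil M x (Matrix.of y - h.lam) : ℝ) : ℂ)) *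
      (Complex.exp (π * Complex.I * (((M * h.kap).trace + bil M h.lam h.mu +
        2 * bil M h.mu (Matrix.of y - h.lam) : ℝ) : ℂ)) * weil M g (onMat f) (Matrix.of y))
  have h2 : ∫ y : Fin m → Fin n → ℝ, Complex.exp (π * Complex.I *
      ((-2 * bil M x (Matrix.of y) : ℝ) : ℂ)) *
        schrodinger M h (weil M g (onMat f)) (Matrix.of y) =
      ∫ y, H (y + Matrix.of.symm h.lam) := by
    refine integral_congr_ae (ae_of_all _ fun y => ?_)
    have e : Matrix.of (y + Matrix.of.symm h.lam) = Matrix.of y + h.lam := rfl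
    simp only [H, schrodinger_eq, e, add_sub_cancel_right]
  have hsub : x + -h.mu = x - h.mu := (sub_eq_add_neg _ _).symm
  rw [h2, integral_add_right_eq_self, schrodinger_eq, hsub, mul_left_comm, ← h1,
    ← integral_const_mul]
  refine integral_congr_ae (ae_of_all _ fun y => ?_)
  simp only [H]
  rw [← mul_assoc, ← mul_assoc, ← exp_pi_mul_I_add, ← exp_pi_mul_I_add]
  congr 4
  simp only [bil_sub_left, bil_sub_right, bil_neg_left, bil_comm hs h.mu h.lam,
    bil_comm hs h.lam x]
  ring

end Theta

/-! ### The transformation laws of theta sums and invariance under the theta group -/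

section Transformation

theorem det_toReal (M : ZMat m m) : (toReal M).det = (M.det : ℝ) := by
  have := (Int.castRingHom ℝ).map_det M
  simpa [toReal, RingHom.mapMatrix_apply] using this.symm

/-- Preimages of the matrices with all columns equal to $e_i$ assemble into an integral right
inverse of $\mathcal M$, so $\det\mathcal M=\pm1$, and positivity excludes $-1$. One column is
needed, hence $n>0$. -/
theorem det_eq_one (hn : 0 < n) {M : ZMat m m} (hM : (toReal M).PosDef)
    (hU : Set.range (fun ω : ZMat m n => M * ω) = Set.univ) : (toReal M).det = 1 := by
  have h1 : ∀ i : Fin m, ∃ ω : ZMat m n, M * ω = Matrix.of fun j _ => if j = i then 1 else 0 :=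
    fun i => Set.range_eq_univ.mp hU _
  choose ω hω using h1
  have h2 : M * Matrix.of (fun j i => ω i j ⟨0, hn⟩) = 1 := by
    ext j i
    have := congrFun (congrFun (hω i) j) ⟨0, hn⟩
    rw [Matrix.mul_apply] at this ⊢
    rw [Matrix.one_apply]
    exact this
  have h3 := congrArg Matrix.det h2
  rw [Matrix.det_mul, Matrix.det_one] at h3
  have hpos := hM.det_pos
  rw [det_toReal] at hpos ⊢
  rcases Int.isUnit_iff.mp (IsUnit.of_mul_eq_one _ h3) with h | h
  · rw [h]; simp
  · rw [h] at hpos; norm_num at hpos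

theorem mul_left_injective_of_posDef {M : ZMat m m} (hM : (toReal M).PosDef) :
    Function.Injective (fun ω : ZMat m n => M * ω) := by
  intro a b hab
  have hu : IsUnit (toReal M).det := isUnit_iff_ne_zero.mpr hM.det_pos.ne'
  have h1 : toReal M * toReal a = toReal M * toReal b := by
    rw [← toReal_mul, ← toReal_mul]
    exact congrArg toReal hab
  have h2 : toReal a = toReal b := by
    have := congrArg (fun x : RMat m n => (toReal M)⁻¹ * x) h1
    simpa only [← Matrix.mul_assoc, Matrix.nonsing_inv_mul _ hu, Matrix.one_mul] using this
  ext i j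
  have := congrFun (congrFun h2 i) j
  simpa [toReal] using this

theorem trace_transpose_toReal_mul {M : ZMat m m} (hM : (toReal M).PosDef) (ω : ZMat m n)
    (y : RMat m n) : ((toReal (M * ω))ᵀ * y).trace = bil (toReal M) (toReal ω) y := by
  rw [toReal_mul, Matrix.transpose_mul, (isSymm_of_posDef hM).eq, bil]

/-- The lower left entry of $(\tau,\phi)$ is $v^{-1/2}\sin\phi$, and $S(\tau,\phi)$ has angle
$\phi+\arg\tau$; positive factors do not affect the sign. -/
theorem cocycle_matS_iwasawa (τ : ℍ) (φ : ℝ) :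
    cocycle m n matS (iwasawa τ φ) =
      Complex.exp (-(Complex.I * Real.pi * (m * n : ℝ) *
        (Real.sign (Real.sin φ * Real.sin (φ + Complex.arg τ)) : ℝ) / 4)) := by
  have hw : 0 < (√τ.im)⁻¹ := inv_pos.mpr (Real.sqrt_pos.mpr τ.im_pos)
  have hw' : 0 < (√(negInv τ).im)⁻¹ := inv_pos.mpr (Real.sqrt_pos.mpr (negInv τ).im_pos)
  have hsign : ∀ r x : ℝ, 0 < r → Real.sign (r * x) = Real.sign x := by
    intro r x hr
    rcases lt_trichotomy x 0 with h | h | h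
    · rw [Real.sign_of_neg h, Real.sign_of_neg (mul_neg_of_pos_of_neg hr h)]
    · rw [h, mul_zero]
    · rw [Real.sign_of_pos h, Real.sign_of_pos (mul_pos hr h)]
  have hS : matS.1 1 0 = 1 := by simp [matS]
  have e : matS.1 1 0 * (iwasawa τ φ).1 1 0 * (matS * iwasawa τ φ).1 1 0 =
      ((√τ.im)⁻¹ * (√(negInv τ).im)⁻¹) * (Real.sin φ * Real.sin (φ + Complex.arg τ)) := by
    rw [← iwasawa_negInv, iwasawa_coe, iwasawa_coe, hS]
    simp
    ring
  rw [cocycle, e, hsign _ _ (mul_pos hw hw')]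

theorem norm_cocycle (g₁ g₂ : SL2R) : ‖cocycle m n g₁ g₂‖ = 1 := by
  have : ∀ r : ℝ, -(Complex.I * Real.pi * (m * n : ℝ) * (r : ℂ) / 4) =
      π * Complex.I * ((-(m * n * r / 4) : ℝ) : ℂ) := fun r => by
    push_cast; ring
  rw [cocycle, this, norm_exp_pi_mul_I]

/-- Poisson summation for $G=\mathscr W(h)R(\tau,\phi)f$. Its Fourier coefficient at $\mathcal
M\omega$ is, up to the cocycle, the term of the transformed theta series at $\omega$, so the dual
side is summable by `summable_thetaTerm` and is reindexed by the bijection $\omega\mapsto\mathcal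
M\omega$. -/
theorem theta_inversion (hn : 0 < n) {M : ZMat m m} (hM : (toReal M).PosDef)
    (hU : Set.range (fun ω : ZMat m n => M * ω) = Set.univ)
    (f : 𝓢(Fin m → Fin n → ℝ, ℂ)) (τ : ℍ) (φ : ℝ) (h : Heis m n) :
    theta (toReal M) f (negInv τ) (φ + Complex.arg τ)
        ⟨-h.mu, h.lam, h.kap, h.isSymm_inversion⟩ =
      cocycle m n matS (iwasawa τ φ) * theta (toReal M) f τ φ h := by
  have hdet := det_eq_one hn hM hU
  let e : ZMat m n ≃ ZMat m n := Equiv.ofBijective (fun ω => M * ω)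
    ⟨mul_left_injective_of_posDef hM, Set.range_eq_univ.mp hU⟩
  obtain ⟨W, hW⟩ := exists_schwartz_eq_weil hM (iwasawa τ φ) f
  let G : (Fin m → Fin n → ℝ) → ℂ := fun y =>
    schrodinger (toReal M) h (weil (toReal M) (iwasawa τ φ) (onMat f)) (Matrix.of y)
  have hGe : ∀ y, G y = Complex.exp (π * Complex.I * ((((toReal M) * h.kap).trace +
      bil (toReal M) h.lam h.mu + 2 * bil (toReal M) h.mu (Matrix.of y) : ℝ) : ℂ)) *
        W (y + Matrix.of.symm h.lam) := fun y => by
    simp only [G, schrodinger_eq, hW]; rfl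
  have hGc : Continuous G := by
    have h1 : Continuous fun y : Fin m → Fin n → ℝ => bil (toReal M) h.mu (Matrix.of y) := by
      have : Continuous fun y : Fin m → Fin n → ℝ => (Matrix.of y : RMat m n) := continuous_id
      exact (continuous_const.matrix_mul this).matrix_trace
    have h2 : Continuous fun y : Fin m → Fin n → ℝ => W (y + Matrix.of.symm h.lam) :=
      W.continuous.comp (continuous_id.add continuous_const)
    rw [show G = _ from funext hGe]
    exact Continuous.mul (by fun_prop) h2
  obtain ⟨C, hC⟩ := exists_decay
    (SchwartzMap.compSubConstCLM ℂ (-(Matrix.of.symm h.lam)) W) (m * n + 1)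
  have hGd : ∀ y, ‖G y‖ ≤ C * (1 + ‖y‖) ^ (-((m * n + 1 : ℕ) : ℝ)) := fun y => by
    rw [hGe, norm_mul, norm_exp_pi_mul_I, one_mul]
    simpa using hC y
  have hF : ∀ ω : ZMat m n, ∫ y : Fin m → Fin n → ℝ, Complex.exp (π * Complex.I *
      ((-2 * ((toReal (e ω))ᵀ * Matrix.of y).trace : ℝ) : ℂ)) * G y =
      (cocycle m n matS (iwasawa τ φ))⁻¹ * thetaTerm (toReal M) f (negInv τ) (φ + Complex.arg τ)
        ⟨-h.mu, h.lam, h.kap, h.isSymm_inversion⟩ ω := fun ω => by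
    have h1 := integral_exp_mul_schrodinger hM (iwasawa τ φ) f h (toReal ω)
    rw [hdet, Real.one_rpow, Complex.ofReal_one, one_mul, ← iwasawa_negInv] at h1
    rw [thetaTerm, jacobiRep, ← h1]
    have h2 : ∀ y : RMat m n, ((toReal (e ω))ᵀ * y).trace = bil (toReal M) (toReal ω) y :=
      trace_transpose_toReal_mul hM ω
    simp only [h2, G]
  have hP := tsum_toReal_eq_tsum_integral hGc (C := C) (r := ((m * n + 1 : ℕ) : ℝ))
    (by push_cast; linarith) hGd (by
      rw [← e.summable_iff]
      exact ((summable_thetaTerm hM f _ _ _).mul_left _).congr fun ω => (hF ω).symm)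
  rw [← e.tsum_eq (fun ω : ZMat m n => ∫ y : Fin m → Fin n → ℝ, _)] at hP
  simp only [hF] at hP
  rw [tsum_mul_left] at hP
  have hc : cocycle m n matS (iwasawa τ φ) ≠ 0 := by
    rw [← norm_ne_zero_iff, norm_cocycle]; exact one_ne_zero
  have hθ : theta (toReal M) f τ φ h = ∑' ω : ZMat m n, G (Matrix.of.symm (toReal ω)) := rfl
  rw [hθ, hP, theta, mul_inv_cancel_left₀ hc]

/-- The exponents of corresponding terms differ by $2\pi i\{(\omega,\omega)_{\mathcal
M}+(s,\omega)_{\mathcal M}\}$. Translating $\tau$ by 2 rather than 1 avoids requiring $\mathcal M$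
to be even. -/
theorem theta_translation {M : ZMat m m} (hM : (toReal M).PosDef)
    (f : 𝓢(Fin m → Fin n → ℝ, ℂ)) (s : ZMat m n) (τ : ℍ) (φ : ℝ) (h : Heis m n) :
    theta (toReal M) f ((2 : ℝ) +ᵥ τ) φ
        ⟨h.lam, toReal s - (2 : ℝ) • h.lam + h.mu, h.kap - toReal s * h.lamᵀ,
          h.isSymm_shift (toReal s)⟩ =
      theta (toReal M) f τ φ h := by
  have hs := isSymm_of_posDef hM
  refine tsum_congr fun ω => ?_
  obtain ⟨k, hk⟩ := exists_int_bil_toReal M ω ω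
  obtain ⟨l, hl⟩ := exists_int_bil_toReal M s ω
  rw [thetaTerm, jacobiRep, thetaTerm, jacobiRep, schrodinger_eq, schrodinger_eq,
    iwasawa_two_vadd, weil_unip_mul, ← mul_assoc, ← exp_pi_mul_I_add]
  congr 1
  have e : ((toReal M * (h.kap - toReal s * h.lamᵀ)).trace +
      bil (toReal M) h.lam (toReal s - (2 : ℝ) • h.lam + h.mu) +
      2 * bil (toReal M) (toReal s - (2 : ℝ) • h.lam + h.mu) (toReal ω) +
      2 * bil (toReal M) (toReal ω + h.lam) (toReal ω + h.lam)) =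
      ((toReal M * h.kap).trace + bil (toReal M) h.lam h.mu + 2 * bil (toReal M) h.mu (toReal ω)) +
        2 * ((k + l : ℤ) : ℝ) := by
    rw [Matrix.mul_sub, Matrix.trace_sub, trace_mul_mul_transpose]
    simp only [bil_add_left, bil_add_right, bil_sub_left, bil_sub_right, bil_smul_left,
      bil_smul_right, hk, hl, bil_comm hs (toReal ω) h.lam]
    push_cast
    ring
  rw [e, exp_pi_mul_I_add, exp_pi_mul_I_two_mul_int, mul_one]

/-- The shift $\omega\mapsto\omega+\lambda_0$ aligns the terms; besides the stated phase there
remains $e^{2\pi i(\mu_0,\omega)_{\mathcal M}}=1$. -/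
theorem theta_mul {M : ZMat m m} (hM : (toReal M).PosDef)
    (f : 𝓢(Fin m → Fin n → ℝ, ℂ)) (h₀ : Heis m n) (h₀i : h₀.IsIntegral) (τ : ℍ) (φ : ℝ)
    (h : Heis m n) :
    theta (toReal M) f τ φ (h₀ * h) =
      Complex.exp (Real.pi * Complex.I *
        ((toReal M * (h₀.kap + h₀.mu * h₀.lamᵀ)).trace : ℝ)) * theta (toReal M) f τ φ h := by
  have hs := isSymm_of_posDef hM
  obtain ⟨l, u, _, hl, hu, -⟩ := h₀i
  rw [theta, theta, ← (Equiv.addRight l).tsum_eq (thetaTerm (toReal M) f τ φ h), ← tsum_mul_left]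
  refine tsum_congr fun ω => ?_
  obtain ⟨k, hk⟩ := exists_int_bil_toReal M u ω
  have hlam : (h₀ * h).lam = h₀.lam + h.lam := rfl
  have hmu : (h₀ * h).mu = h₀.mu + h.mu := rfl
  have hkap : (h₀ * h).kap = h₀.kap + h.kap + h₀.lam * h.muᵀ - h₀.mu * h.lamᵀ := rfl
  rw [thetaTerm, jacobiRep, thetaTerm, jacobiRep, schrodinger_eq, schrodinger_eq, hlam, hmu, hkap,
    Equiv.coe_addRight, toReal_add, ← hl, ← mul_assoc, ← exp_pi_mul_I_add, add_assoc (toReal ω)]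
  congr 1
  have e : (toReal M * (h₀.kap + h.kap + h₀.lam * h.muᵀ - h₀.mu * h.lamᵀ)).trace +
      bil (toReal M) (h₀.lam + h.lam) (h₀.mu + h.mu) +
      2 * bil (toReal M) (h₀.mu + h.mu) (toReal ω) =
      (toReal M * (h₀.kap + h₀.mu * h₀.lamᵀ)).trace + ((toReal M * h.kap).trace +
        bil (toReal M) h.lam h.mu + 2 * bil (toReal M) h.mu (toReal ω + h₀.lam)) +
        2 * (k : ℝ) := by
    simp only [Matrix.mul_sub, Matrix.mul_add, Matrix.trace_sub, Matrix.trace_add,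
      trace_mul_mul_transpose, bil_add_left, bil_add_right, ← hk, ← hu]
    rw [bil_comm hs h₀.lam h.mu]
    ring
  rw [e, exp_pi_mul_I_add, exp_pi_mul_I_two_mul_int, mul_one]

/-! ### The theta sum without the central variable -/

/-- Peeling the two upper triangular Iwasawa factors off $R(\tau,\phi)$ gives the explicit series.
The remaining prefactor is a phase independent of $f$, which cancels in `thetaProd_eq`. -/
theorem theta_eq_mul_thetaV (M : RMat m m) (f : 𝓢(Fin m → Fin n → ℝ, ℂ)) (τ : ℍ) (φ : ℝ)
    (h : Heis m n) (hs : M.IsSymm) :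
    theta M f τ φ h = Complex.exp (π * Complex.I *
      (((M * h.kap).trace + bil M h.lam h.mu : ℝ) : ℂ)) * thetaV M f τ φ h.lam h.mu := by
  rw [theta, thetaV, ← tsum_mul_left, ← tsum_mul_left]
  refine tsum_congr fun ω => ?_
  rw [thetaTerm, jacobiRep, schrodinger_eq, iwasawa, mul_assoc (unip _), weil_unip_mul,
    weil_diagEl_mul, iwasawa_I, bil_comm hs h.mu]
  simp only [exp_pi_mul_I_add]
  ring

/-- The product of two theta sums, in the coordinates `(τ, φ; λ, μ)`. -/
noncomputable def thetaProd (M : RMat m m) (f g : 𝓢(Fin m → Fin n → ℝ, ℂ)) (τ : ℍ) (φ : ℝ)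
    (lam mu : RMat m n) : ℂ :=
  thetaV M f τ φ lam mu * (starRingEnd ℂ) (thetaV M g τ φ lam mu)

theorem mul_conj_mul_of_norm_eq_one {c : ℂ} (hc : ‖c‖ = 1) (z w : ℂ) :
    c * z * (starRingEnd ℂ) (c * w) = z * (starRingEnd ℂ) w := by
  have : c * (starRingEnd ℂ) c = 1 := by rw [Complex.mul_conj']; simp [hc]
  rw [map_mul]
  linear_combination (z * (starRingEnd ℂ) w) * this

theorem thetaProd_eq (M : RMat m m) (hs : M.IsSymm) (f g : 𝓢(Fin m → Fin n → ℝ, ℂ)) (τ : ℍ)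
    (φ : ℝ) (h : Heis m n) :
    thetaProd M f g τ φ h.lam h.mu =
      theta M f τ φ h * (starRingEnd ℂ) (theta M g τ φ h) := by
  rw [theta_eq_mul_thetaV M f τ φ h hs, theta_eq_mul_thetaV M g τ φ h hs,
    mul_conj_mul_of_norm_eq_one (norm_exp_pi_mul_I _), thetaProd]

/-- An element of the Heisenberg group with given `λ` and `μ`. -/
def Heis.ofPair (lam mu : RMat m n) : Heis m n :=
  ⟨lam, mu, -(mu * lamᵀ), by rw [neg_add_cancel]; exact Matrix.isSymm_zero⟩

theorem thetaProd_inversion (hn : 0 < n) {M : ZMat m m} (hM : (toReal M).PosDef)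
    (hU : Set.range (fun ω : ZMat m n => M * ω) = Set.univ)
    (f g : 𝓢(Fin m → Fin n → ℝ, ℂ)) (τ : ℍ) (φ : ℝ) (lam mu : RMat m n) :
    thetaProd (toReal M) f g (negInv τ) (φ + Complex.arg τ) (-mu) lam =
      thetaProd (toReal M) f g τ φ lam mu := by
  have hs := isSymm_of_posDef hM
  have h1 := thetaProd_eq (toReal M) hs f g τ φ (Heis.ofPair lam mu)
  have h2 := thetaProd_eq (toReal M) hs f g (negInv τ) (φ + Complex.arg τ)
    ⟨-(Heis.ofPair lam mu).mu, (Heis.ofPair lam mu).lam, (Heis.ofPair lam mu).kap,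
      (Heis.ofPair lam mu).isSymm_inversion⟩
  rw [theta_inversion hn hM hU, theta_inversion hn hM hU,
    mul_conj_mul_of_norm_eq_one (norm_cocycle _ _), ← h1] at h2
  exact h2

theorem thetaProd_translation {M : ZMat m m} (hM : (toReal M).PosDef)
    (f g : 𝓢(Fin m → Fin n → ℝ, ℂ)) (s : ZMat m n) (τ : ℍ) (φ : ℝ) (lam mu : RMat m n) :
    thetaProd (toReal M) f g ((2 : ℝ) +ᵥ τ) φ lam (toReal s - (2 : ℝ) • lam + mu) =
      thetaProd (toReal M) f g τ φ lam mu := by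
  have hs := isSymm_of_posDef hM
  have h1 := thetaProd_eq (toReal M) hs f g τ φ (Heis.ofPair lam mu)
  have h2 := thetaProd_eq (toReal M) hs f g ((2 : ℝ) +ᵥ τ) φ
    ⟨(Heis.ofPair lam mu).lam, toReal s - (2 : ℝ) • (Heis.ofPair lam mu).lam +
      (Heis.ofPair lam mu).mu, (Heis.ofPair lam mu).kap - toReal s * (Heis.ofPair lam mu).lamᵀ,
      (Heis.ofPair lam mu).isSymm_shift (toReal s)⟩
  rw [theta_translation hM, theta_translation hM, ← h1] at h2
  exact h2

theorem thetaProd_add {M : ZMat m m} (hM : (toReal M).PosDef)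
    (f g : 𝓢(Fin m → Fin n → ℝ, ℂ)) (l u : ZMat m n) (τ : ℍ) (φ : ℝ) (lam mu : RMat m n) :
    thetaProd (toReal M) f g τ φ (toReal l + lam) (toReal u + mu) =
      thetaProd (toReal M) f g τ φ lam mu := by
  have hs := isSymm_of_posDef hM
  have h1 := thetaProd_eq (toReal M) hs f g τ φ (Heis.ofPair lam mu)
  have h2 := thetaProd_eq (toReal M) hs f g τ φ
    (Heis.ofPair (toReal l) (toReal u) * Heis.ofPair lam mu)
  have hi : (Heis.ofPair (toReal l) (toReal u)).IsIntegral := by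
    refine ⟨l, u, -(u * lᵀ), rfl, rfl, ?_⟩
    have : toReal (-(u * lᵀ)) = -toReal (u * lᵀ) := by ext i j; simp [toReal]
    rw [this, toReal_mul]
    rfl
  rw [theta_mul hM f _ hi, theta_mul hM g _ hi,
    mul_conj_mul_of_norm_eq_one (norm_exp_pi_mul_I _), ← h1] at h2
  exact h2

/-! ### Invariance under the theta group -/

theorem ofCoord_eq (τ : ℍ) (φ : ℝ) (lam mu : RMat m n) :
    ofCoord τ φ lam mu = ⟨iwasawa τ φ, rAct (lam, mu) (iwasawa τ φ)⟩ := by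
  rw [ofCoord, GV.mul_def, one_mul, add_zero]

/-- The length of the bottom row determines $v$, hence $\sin\phi$ and $\cos\phi$; pairing the top
row with $(\sin\phi,\cos\phi)$ then recovers $u$. The angle is determined only modulo $2\pi$, hence
the conclusion about `rot`. -/
theorem iwasawa_injective {τ τ' : ℍ} {φ φ' : ℝ} (h : iwasawa τ φ = iwasawa τ' φ') :
    τ = τ' ∧ rot φ = rot φ' := by
  have hv := Real.sqrt_pos.mpr τ.im_pos
  have hv' := Real.sqrt_pos.mpr τ'.im_pos
  have hw := Real.sq_sqrt τ.im_pos.le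
  have hw' := Real.sq_sqrt τ'.im_pos.le
  have h1 := congrArg Subtype.val h
  rw [iwasawa_coe, iwasawa_coe] at h1
  have h00 := congrFun (congrFun h1 0) 0
  have h01 := congrFun (congrFun h1 0) 1
  have h10 := congrFun (congrFun h1 1) 0
  have h11 := congrFun (congrFun h1 1) 1
  simp only [Matrix.of_apply, Matrix.cons_val', Matrix.cons_val_zero, Matrix.cons_val_one,
    Matrix.cons_val_fin_one] at h00 h01 h10 h11
  have hcs := Real.sin_sq_add_cos_sq φ
  have hcs' := Real.sin_sq_add_cos_sq φ'
  have hinv : (√τ.im)⁻¹ ^ 2 = (√τ'.im)⁻¹ ^ 2 := by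
    have e1 : ((√τ.im)⁻¹ * Real.sin φ) ^ 2 + ((√τ.im)⁻¹ * Real.cos φ) ^ 2 = (√τ.im)⁻¹ ^ 2 := by
      linear_combination ((√τ.im)⁻¹ ^ 2) * hcs
    have e2 : ((√τ'.im)⁻¹ * Real.sin φ') ^ 2 + ((√τ'.im)⁻¹ * Real.cos φ') ^ 2 =
        (√τ'.im)⁻¹ ^ 2 := by
      linear_combination ((√τ'.im)⁻¹ ^ 2) * hcs'
    rw [← e1, ← e2, h10, h11]
  have hsq : √τ.im = √τ'.im := by
    have := (sq_eq_sq₀ (inv_pos.mpr hv).le (inv_pos.mpr hv').le).mp hinv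
    exact inv_injective this
  have him : τ.im = τ'.im := by rw [← hw, ← hw', hsq]
  rw [← hsq] at h00 h01 h10 h11
  have hi := inv_ne_zero hv.ne'
  have hsin : Real.sin φ = Real.sin φ' := mul_left_cancel₀ hi h10
  have hcos : Real.cos φ = Real.cos φ' := mul_left_cancel₀ hi h11
  have hre : τ.re = τ'.re := by
    rw [← hsin, ← hcos] at h00 h01
    have : (√τ.im)⁻¹ * τ.re = (√τ.im)⁻¹ * τ'.re := by
      linear_combination (Real.sin φ) * h00 + (Real.cos φ) * h01 -
        ((√τ.im)⁻¹ * τ.re - (√τ.im)⁻¹ * τ'.re) * hcs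
    exact mul_left_cancel₀ hi this
  refine ⟨UpperHalfPlane.ext (Complex.ext hre him), ?_⟩
  apply Subtype.ext
  simp only [rot, hsin, hcos]

theorem exists_iwasawa_eq (g : SL2R) : ∃ (τ : ℍ) (φ : ℝ), iwasawa τ φ = g := by
  have hdet := g.2
  rw [Matrix.det_fin_two] at hdet
  set a := g.1 0 0
  set b := g.1 0 1
  set c := g.1 1 0
  set d := g.1 1 1
  have hpos : 0 < c ^ 2 + d ^ 2 := by
    by_contra hcon
    have hc : c = 0 := by nlinarith [sq_nonneg c, sq_nonneg d]
    have hd : d = 0 := by nlinarith [sq_nonneg c, sq_nonneg d]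
    rw [hc, hd] at hdet
    simp at hdet
  -- The bottom row must be $v^{-1/2}(\sin\phi,\cos\phi)$, so $\phi$ is the argument of $d+ic$ and
  -- $v=|d+ic|^{-2}$.
  let z : ℂ := ⟨d, c⟩
  have hz : z ≠ 0 := by
    intro h
    have h1 : d = 0 := congrArg Complex.re h
    have h2 : c = 0 := congrArg Complex.im h
    rw [h1, h2] at hpos
    simp at hpos
  set r := ‖z‖ with hr
  have hr0 : 0 < r := norm_pos_iff.mpr hz
  have hr2 : r ^ 2 = c ^ 2 + d ^ 2 := by
    rw [hr, Complex.sq_norm, Complex.normSq_apply]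
    simp only [z]
    ring
  have hcos : Real.cos (Complex.arg z) = d / r := Complex.cos_arg hz
  have hsin : Real.sin (Complex.arg z) = c / r := Complex.sin_arg z
  refine ⟨⟨⟨(a * c + b * d) / r ^ 2, (r⁻¹) ^ 2⟩, by positivity⟩, Complex.arg z, ?_⟩
  apply Subtype.ext
  rw [iwasawa_coe]
  have him : ∀ (x y : ℝ) (h : 0 < (⟨x, y⟩ : ℂ).im), (UpperHalfPlane.mk ⟨x, y⟩ h).im = y :=
    fun _ _ _ => rfl
  have hre : ∀ (x y : ℝ) (h : 0 < (⟨x, y⟩ : ℂ).im), (UpperHalfPlane.mk ⟨x, y⟩ h).re = x :=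
    fun _ _ _ => rfl
  rw [him, hre, Real.sqrt_sq (inv_pos.mpr hr0).le, hcos, hsin, inv_inv]
  have h00 : g.1 0 0 = a := rfl
  have h01 : g.1 0 1 = b := rfl
  have h10 : g.1 1 0 = c := rfl
  have h11 : g.1 1 1 = d := rfl
  rw [Matrix.eta_fin_two g.1, h00, h01, h10, h11]
  ext i j
  fin_cases i <;> fin_cases j <;> simp <;> field_simp
  · rw [hr2]; linear_combination (-d) * hdet
  · rw [hr2]; linear_combination c * hdet

theorem exists_ofCoord_eq (x : GV m n) :
    ∃ (τ : ℍ) (φ : ℝ) (lam mu : RMat m n), ofCoord τ φ lam mu = x := by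
  obtain ⟨τ, φ, h⟩ := exists_iwasawa_eq x.sl
  refine ⟨τ, φ, (rAct x.vec x.sl⁻¹).1, (rAct x.vec x.sl⁻¹).2, ?_⟩
  rw [ofCoord_eq, h, Prod.mk.eta, ← rAct_mul, inv_mul_cancel, rAct_one]

/-- Makes the product a well-defined function on the group: `thetaV` sees $\phi$ only through the
rotation. -/
theorem thetaProd_congr (M : RMat m m) (f g : 𝓢(Fin m → Fin n → ℝ, ℂ)) {τ τ' : ℍ} {φ φ' : ℝ}
    {lam mu lam' mu' : RMat m n} (h : ofCoord τ φ lam mu = ofCoord τ' φ' lam' mu') :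
    thetaProd M f g τ φ lam mu = thetaProd M f g τ' φ' lam' mu' := by
  rw [ofCoord_eq, ofCoord_eq, GV.mk.injEq] at h
  obtain ⟨h1, h2⟩ := h
  have h3 := congrArg (fun p => rAct p (iwasawa τ' φ')⁻¹) h2
  simp only [h1, ← rAct_mul, mul_inv_cancel, rAct_one, Prod.mk.injEq] at h3
  obtain ⟨h4, h5⟩ := iwasawa_injective h1
  rw [h3.1, h3.2, h4]
  unfold thetaProd thetaV
  rw [iwasawa_I, iwasawa_I, h5]

/-- Since $(-\mu,\lambda)S=(\lambda,\mu)$, left multiplication by this generator is the coordinate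
change of the inversion law. -/
theorem matS_mul_ofCoord (τ : ℍ) (φ : ℝ) (lam mu : RMat m n) :
    (⟨matS, 0⟩ : GV m n) * ofCoord τ φ lam mu =
      ofCoord (negInv τ) (φ + Complex.arg τ) (-mu) lam := by
  rw [ofCoord_eq, ofCoord_eq, GV.mul_def, rAct_zero, zero_add, iwasawa_negInv, rAct_mul]
  congr 2
  simp [rAct, matS]

theorem unip_mul_ofCoord (s : RMat m n) (τ : ℍ) (φ : ℝ) (lam mu : RMat m n) :
    (⟨unip 2, (0, s)⟩ : GV m n) * ofCoord τ φ lam mu =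
      ofCoord ((2 : ℝ) +ᵥ τ) φ lam (s - (2 : ℝ) • lam + mu) := by
  rw [ofCoord_eq, ofCoord_eq, GV.mul_def, ← rAct_add, iwasawa_two_vadd, rAct_mul]
  congr 2
  ext i j <;> simp [rAct, unip]; ring

theorem one_mul_ofCoord (l u : RMat m n) (τ : ℍ) (φ : ℝ) (lam mu : RMat m n) :
    (⟨1, (l, u)⟩ : GV m n) * ofCoord τ φ lam mu = ofCoord τ φ (l + lam) (u + mu) := by
  rw [ofCoord_eq, ofCoord_eq, GV.mul_def, ← rAct_add, one_mul, Prod.mk_add_mk]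

theorem thetaProd_eq_of_mem_Gamma2 (hn : 0 < n) {M : ZMat m m} (hM : (toReal M).PosDef)
    (hU : Set.range (fun ω : ZMat m n => M * ω) = Set.univ)
    (f g : 𝓢(Fin m → Fin n → ℝ, ℂ)) {γ : GV m n} (hγ : γ ∈ Gamma2 m n) (τ τ' : ℍ) (φ φ' : ℝ)
    (lam mu lam' mu' : RMat m n) (h : ofCoord τ' φ' lam' mu' = γ * ofCoord τ φ lam mu) :
    thetaProd (toReal M) f g τ' φ' lam' mu' = thetaProd (toReal M) f g τ φ lam mu := by
  induction hγ using Subgroup.closure_induction generalizing τ τ' φ φ' lam mu lam' mu' with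
  | mem x hx =>
    rcases hx with (rfl | ⟨s, rfl⟩) | ⟨l, u, rfl⟩
    · rw [matS_mul_ofCoord] at h
      rw [thetaProd_congr _ f g h, thetaProd_inversion hn hM hU]
    · rw [unip_mul_ofCoord] at h
      rw [thetaProd_congr _ f g h, thetaProd_translation hM]
    · rw [one_mul_ofCoord] at h
      rw [thetaProd_congr _ f g h, thetaProd_add hM]
  | one =>
    rw [one_mul] at h
    exact thetaProd_congr _ f g h
  | mul x y _ _ ihx ihy =>
    -- The intermediate point needs coordinates of its own, so surjectivity of `ofCoord` is used and
    -- the induction is stated for all coordinates.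
    obtain ⟨τ₁, φ₁, lam₁, mu₁, h₁⟩ := exists_ofCoord_eq (y * ofCoord τ φ lam mu)
    rw [mul_assoc, ← h₁] at h
    exact (ihx _ _ _ _ _ _ _ _ h).trans (ihy _ _ _ _ _ _ _ _ h₁)
  | inv x _ ih =>
    exact (ih _ _ _ _ _ _ _ _ (eq_inv_mul_iff_mul_eq.mp h).symm).symm

end Transformation

end JacobiTheta

open JacobiTheta
theorem theorem12p1 (m n : ℕ) (hm : 0 < m) (hn : 0 < n)
    (M : ZMat m m) (hM : (toReal M).PosDef) :
    -- the theta series converge absolutely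
    (∀ (f : 𝓢(Fin m → Fin n → ℝ, ℂ)) (τ : ℍ) (φ : ℝ) (h : Heis m n),
      Summable (thetaTerm (toReal M) f τ φ h)) ∧
    -- Jacobi 1, with the explicit value of the cocycle
    (Set.range (fun ω : ZMat m n => M * ω) = Set.univ →
      ∀ (f : 𝓢(Fin m → Fin n → ℝ, ℂ)) (τ : ℍ) (φ : ℝ) (h : Heis m n),
        theta (toReal M) f (negInv τ) (φ + Complex.arg τ)
            ⟨-h.mu, h.lam, h.kap, h.isSymm_inversion⟩ =
          (((toReal M).det ^ (-(n : ℝ) / 2) : ℝ) : ℂ) * cocycle m n matS (iwasawa τ φ) *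
            theta (toReal M) f τ φ h ∧
        cocycle m n matS (iwasawa τ φ) =
          Complex.exp (-(Complex.I * Real.pi * (m * n : ℝ) *
            (Real.sign (Real.sin φ * Real.sin (φ + Complex.arg τ)) : ℝ) / 4))) ∧
    -- Jacobi 2
    (∀ (f : 𝓢(Fin m → Fin n → ℝ, ℂ)) (s : ZMat m n) (τ : ℍ) (φ : ℝ) (h : Heis m n),
      theta (toReal M) f ((2 : ℝ) +ᵥ τ) φ
          ⟨h.lam, toReal s - (2 : ℝ) • h.lam + h.mu, h.kap - toReal s * h.lamᵀ,
            h.isSymm_shift (toReal s)⟩ =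
        theta (toReal M) f τ φ h) ∧
    -- Jacobi 3
    (∀ (f : 𝓢(Fin m → Fin n → ℝ, ℂ)) (h₀ : Heis m n), h₀.IsIntegral →
      ∀ (τ : ℍ) (φ : ℝ) (h : Heis m n),
        theta (toReal M) f τ φ (h₀ * h) =
          Complex.exp (Real.pi * Complex.I *
            ((toReal M * (h₀.kap + h₀.mu * h₀.lamᵀ)).trace : ℝ)) *
            theta (toReal M) f τ φ h) ∧
    -- invariance of the product under left multiplication by the theta group
    (Set.range (fun ω : ZMat m n => M * ω) = Set.univ →
      ∀ (f g : 𝓢(Fin m → Fin n → ℝ, ℂ)), ∀ γ ∈ Gamma2 m n,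
        ∀ (τ τ' : ℍ) (φ φ' : ℝ) (lam mu lam' mu' : RMat m n),
          ofCoord τ' φ' lam' mu' = γ * ofCoord τ φ lam mu →
          thetaV (toReal M) f τ' φ' lam' mu' *
              (starRingEnd ℂ) (thetaV (toReal M) g τ' φ' lam' mu') =
            thetaV (toReal M) f τ φ lam mu *
              (starRingEnd ℂ) (thetaV (toReal M) g τ φ lam mu)) := by
  refine ⟨fun f τ φ h => summable_thetaTerm hM f τ φ h, fun hU f τ φ h => ⟨?_, ?_⟩,
    fun f s τ φ h => theta_translation hM f s τ φ h,
    fun f h₀ hi τ φ h => theta_mul hM f h₀ hi τ φ h,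
    fun hU f g γ hγ τ τ' φ φ' lam mu lam' mu' h =>
      thetaProd_eq_of_mem_Gamma2 hn hM hU f g hγ τ τ' φ φ' lam mu lam' mu' h⟩
  -- Unimodularity and positivity give $\det\mathcal M=1$, so the determinant factor equals 1.
  · rw [det_eq_one hn hM hU, Real.one_rpow, Complex.ofReal_one, one_mul]
    exact theta_inversion hn hM hU f τ φ h
  · exact cocycle_matS_iwasawa τ φ
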